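/- **Theorem 7.1.** Let $t>0$. Let $\Delta$ be the set of sequences $\alpha=(\alpha_1\ge\alpha_2\ge\dots\ge0)$ with $\sum_i\alpha_i\le1$, with the topology of coordinatewise convergence and its Borel $\sigma$-algebra, and put $\gamma=\gamma(\alpha)=1-\sum_i\alpha_i$. For an element $f$ of the algebra of symmetric functions $\Lambda=\mathbb R[p_1,p_2,\dots]$ ($p_k$ the power sums) let $\tilde f(\alpha)$ be its image under the algebra morphism $p_1\mapsto\sum_i\alpha_i+\gamma=1$, $p_k\mapsto\sum_i\alpha_i^k$ $(k\ge2)$. Let $PD(t)$ be the Poisson--Dirichlet distribution, i.e. the probability measure $P$ on $\Delta$ such that $$\int_\Delta\tilde m_\lambda(\alpha)\,P(d\alpha)=\frac{M^{(t)}(\lambda)}{\dim_0\lambda}\quad\text{for all partitions }\lambda,\qquad M^{(t)}(\lambda)=\frac{t^{\ell(\lambda)}\,|\lambda|!}{t(t+1)\cdots(t+|\lambda|-1)\,z_\lambda},\qquad z_\lambda=\prod_i\lambda_i\cdot\prod_k r_k(\lambda)!;$$ such a measure exists and is unique. Here $m_\lambda$ is the monomial symmetric function, $\ell(\lambda)$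 is the number of parts of $\lambda$, $r_k(\lambda)$ is the number of parts equal to $k$, and $\dim_0\lambda$ is the number of oriented paths from $\varnothing$ to $\lambda$ in the Kingman graph, where the edge from $\mu$ to $\lambda$ (with $\lambda$ obtained from $\mu$ by replacing one part $k-1$ by $k$, or by adding a part $1$ if $k=1$) has multiplicity $r_k(\lambda)$. For $n\ge1$ let $$\sigma^{(t)}_n=\int_\Delta\underbrace{\nu_\alpha\times\dots\times\nu_\alpha}_{n}\;PD(t)(d\alpha),\qquad \nu_\alpha=\sum_i\alpha_i\,\delta(\alpha_i)+\gamma\,\delta(0),$$ be the $n$-th controlling measure of $PD(t)$ (a probability measure on $[0,1]^n$). Let $\Pi(n,r)$ be the set of partitions of $\{1,\dots,n\}$ into $r$ nonempty blocks. For $\pi\in\Pi(n,r)$ with blocks enumerated in any way as $\pi_1,\dots,\pi_r$, let $\sigma^{(t)}_{n,r,\pi}$ be the image of the measure $$t^r\prod_{i=1}^r y_i^{|\pi_i|-1}\cdot\Bigl(1-\sum_{i=1}^r y_i\Bigr)_+^{t-1}\,dy\quad\text{on }[0,1]^r$$ (where $u_+^{s}=u^{s}$ for $u>0$ and $u_+^s=0$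 for $u\le0$) under the map $y\mapsto x$, $x_j=y_i$ for $j\in\pi_i$, which is a bijection of $[0,1]^r$ onto the diagonal section $\{x\in[0,1]^n: x_j=x_k\text{ whenever } j,k\text{ lie in the same block of }\pi\}$; it does not depend on the enumeration. Then $$\sigma^{(t)}_n=\sum_{r=1}^n\ \sum_{\pi\in\Pi(n,r)}\sigma^{(t)}_{n,r,\pi}.$$ -/

import Mathlib

open MeasureTheory

namespace PoissonDirichlet

/-! ### The simplex, extended power sums, monomial symmetric functions -/

/-- The simplex `Δ` of sequences `α₁ ≥ α₂ ≥ … ≥ 0` with `∑ αᵢ ≤ 1` (indexed from `0` here).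
As a subtype of `ℕ → ℝ` it carries the topology of coordinatewise convergence and the
σ-algebra generated by the coordinates. -/
def simplex : Set (ℕ → ℝ) :=
  {α | Antitone α ∧ (∀ i, 0 ≤ α i) ∧ Summable α ∧ ∑' i, α i ≤ 1}

/-- The defect `γ = 1 - ∑ αᵢ`. -/
noncomputable def gam (α : simplex) : ℝ := 1 - ∑' i, α.1 i

/-- The extended power sums: `p̃₁ = ∑ αᵢ + γ`, and `p̃ₖ = ∑ αᵢ ^ k` for `k ≥ 2`. -/
noncomputable def extPowerSum (α : simplex) (k : ℕ+) : ℝ :=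
  if k = 1 then ∑' i, α.1 i + gam α else ∑' i, α.1 i ^ (k : ℕ)

/-- The algebra of symmetric functions over `ℝ`, that is, `ℝ[p₁, p₂, …]`. -/
abbrev SymFun : Type := MvPolynomial ℕ+ ℝ

/-- The specialization `f ↦ f̃(α)`: the algebra morphism sending `pₖ` to `p̃ₖ(α)`. -/
noncomputable def specialize (α : simplex) (f : SymFun) : ℝ :=
  MvPolynomial.aeval (extPowerSum α) f

/-- The symmetric function `f` is the monomial symmetric function `m_lam`: for every `N`, the
substitution `pₖ ↦ x₁ ^ k + ⋯ + x_N ^ k` turns `f` into the sum of all distinct monomials obtained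
from `x ^ lam` by permuting the variables `x₁, …, x_N`. -/
def IsMonomialSymm {n : ℕ} (lam : n.Partition) (f : SymFun) : Prop :=
  ∀ N : ℕ, MvPolynomial.aeval (fun k : ℕ+ => MvPolynomial.psum (Fin N) ℝ (k : ℕ)) f
    = MvPolynomial.msymm (Fin N) ℝ lam

/-! ### The Kingman graph and the Ewens partition structures -/

/-- The multiplicity `κ₀(mu, lam)` of the edge from `mu` to `lam` in the Kingman graph. If `lam` is
obtained from `mu` by replacing one part `k - 1` by `k` (by adding a new part `1` when `k = 1`),
it is the multiplicity of the part `k` in `lam`; otherwise it is `0`. At most one `k` contributes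
to the sum. -/
def edgeMult {n : ℕ} (mu : n.Partition) (lam : (n + 1).Partition) : ℕ :=
  ∑ k ∈ lam.parts.toFinset,
    if (if k = 1 then lam.parts.erase k else (k - 1) ::ₘ lam.parts.erase k) = mu.parts
    then lam.parts.count k else 0

/-- `dim₀ lam`: the number of oriented paths from the empty partition to `lam` in the Kingman graph,
counted with edge multiplicities. -/
def dimKingman : (n : ℕ) → n.Partition → ℕ
  | 0, _ => 1
  | n + 1, lam => ∑ mu : n.Partition, dimKingman n mu * edgeMult mu lam

/-- `z_lam = ∏ lamᵢ · ∏ₖ rₖ(lam)!`, where `rₖ(lam)` is the multiplicity of the part `k`. -/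
def zee {n : ℕ} (lam : n.Partition) : ℕ :=
  lam.parts.prod * ∏ k ∈ lam.parts.toFinset, (lam.parts.count k).factorial

/-- The Ewens partition structure `M⁽ᵗ⁾ₙ(lam) = t ^ ℓ(lam) · n! / ((t)ₙ · z_lam)`. -/
noncomputable def ewens (t : ℝ) {n : ℕ} (lam : n.Partition) : ℝ :=
  t ^ lam.parts.card * n.factorial / ((ascPochhammer ℝ n).eval t * zee lam)

/-- `P` is the Poisson--Dirichlet distribution `PD(t)`: the probability measure on the simplex
that corresponds to the coherent system `M⁽ᵗ⁾` on the Kingman graph, that is,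
`∫ m̃_lam dP = M⁽ᵗ⁾(lam) / dim₀ lam` for all partitions `lam`. -/
structure IsPoissonDirichlet (t : ℝ) (P : Measure simplex) : Prop where
  isProbabilityMeasure : IsProbabilityMeasure P
  integral_monomial : ∀ (n : ℕ) (lam : n.Partition) (f : SymFun), IsMonomialSymm lam f →
    ∫ α, specialize α f ∂P = ewens t lam / dimKingman n lam

/-! ### Controlling measures -/

/-- The Thoma measure `ν_α = ∑ αᵢ δ(αᵢ) + γ δ(0)`. -/
noncomputable def thomaMeasure (α : simplex) : Measure ℝ :=
  Measure.sum (fun i => ENNReal.ofReal (α.1 i) • Measure.dirac (α.1 i))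
    + ENNReal.ofReal (gam α) • Measure.dirac 0

/-- The `n`-th controlling measure `σₙ = ∫ ν_α × ⋯ × ν_α P(dα)` (`n` factors). It is a measure
on `ℝⁿ` concentrated on the cube `[0,1]ⁿ`. -/
noncomputable def controllingMeasure (P : Measure simplex) (n : ℕ) : Measure (Fin n → ℝ) :=
  P.bind (fun α => Measure.pi (fun _ : Fin n => thomaMeasure α))

/-! ### The measures attached to set partitions -/

/-- `Π(n, r)`: partitions of an `n`-element set into `r` nonempty blocks. -/
abbrev SetPartition (n r : ℕ) : Type :=
  {π : Finpartition (Finset.univ : Finset (Fin n)) // π.parts.card = r}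

/-- The enumerations of the blocks of `π`. A partition with such an enumeration is an ordered
partition. -/
abbrev SetPartition.Enumeration {n r : ℕ} (π : SetPartition n r) : Type :=
  Fin r ≃ {B : Finset (Fin n) // B ∈ π.1.parts}

/-- The index of the block that contains `j`. -/
def SetPartition.blockIndex {n r : ℕ} {π : SetPartition n r} (e : π.Enumeration) (j : Fin n) :
    Fin r :=
  e.symm ⟨π.1.part j, π.1.part_mem.2 (Finset.mem_univ j)⟩

/-- The power `u₊ ^ s`, equal to `u ^ s` for `u > 0` and to `0` for `u ≤ 0` (also when `s = 0`). -/
noncomputable def posPow (u s : ℝ) : ℝ := if 0 < u then u ^ s else 0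

/-- The measure `t ^ r ∏ yᵢ ^ (|πᵢ| - 1) (1 - ∑ yᵢ)₊ ^ (t - 1) dy` on the cube `[0,1]ʳ`, where `πᵢ`
is the `i`-th block (blocks are nonempty, so `|πᵢ| - 1` is a true subtraction). -/
noncomputable def dirichletTypeMeasure (t : ℝ) {n r : ℕ} {π : SetPartition n r}
    (e : π.Enumeration) : Measure (Fin r → ℝ) :=
  (volume.restrict (Set.Icc 0 1)).withDensity fun y =>
    ENNReal.ofReal (t ^ r * (∏ i, y i ^ ((e i).1.card - 1)) * posPow (1 - ∑ i, y i) (t - 1))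

/-- The image of `dirichletTypeMeasure` under the bijection `y ↦ x` from `[0,1]ʳ` onto the diagonal
section of `[0,1]ⁿ` given by `π`, where `xⱼ = yᵢ` if `j` is in the `i`-th block. -/
noncomputable def sectionMeasure (t : ℝ) {n r : ℕ} {π : SetPartition n r}
    (e : π.Enumeration) : Measure (Fin n → ℝ) :=
  (dirichletTypeMeasure t e).map fun y j => y (SetPartition.blockIndex e j)

end PoissonDirichlet

/-!
The argument compares moments. For `k : ι → ℕ` with all `kᵢ ≥ 1` and `∑ kᵢ = n`, consider the
*augmented* monomial symmetric function `∑ ∏ᵢ x_{f i} ^ kᵢ`, the sum running over all injective `f`;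
it is `∏ rₘ!` times `m_k`. Since `dim₀ λ = n! / ∏ λᵢ!`, a measure is `PD(t)` exactly when each
augmented monomial has integral `t ^ |ι| ∏ᵢ (kᵢ - 1)! / (t)ₙ`.

*Uniqueness.* The extended power sums are continuous and separate the points of the compact simplex,
so by Stone–Weierstrass the integrals of the `f̃` determine a measure.

*Existence.* The symmetric Dirichlet law on `N + 1` points with parameters `t / (N + 1)` has
augmented moments converging to the required ones as `N → ∞`. Sorting the coordinates puts these
laws on the compact simplex, and any weak limit point is `PD(t)`.

*Controlling measures.* The moment `∫ ∏ⱼ xⱼ ^ cⱼ dσₙ` is the `PD(t)`-integral of `∏ⱼ p̃_{cⱼ + 1}`.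
A product of power sums expands over set partitions of its index set into augmented monomials, the
exponents of a block being added up. By the Dirichlet integral the term of a set partition `π` is
the corresponding moment of `σ_{n,r,π}`, and moments determine a finite measure on the cube.
-/

namespace PoissonDirichlet

open Filter Topology

section Blocks

variable {ι : Type*} [Fintype ι] [DecidableEq ι]

/-- The type of blocks of a set partition. -/
abbrev Block (π : Finpartition (Finset.univ : Finset ι)) : Type _ :=
  {B : Finset ι // B ∈ π.parts}

/-- The block of `π` that contains `j`. -/
def block (π : Finpartition (Finset.univ : Finset ι)) (j : ι) : Block π :=
  ⟨π.part j, π.part_mem.2 (Finset.mem_univ j)⟩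

/-- The total of the exponents `k` over a block. -/
def blockSum (π : Finpartition (Finset.univ : Finset ι)) (k : ι → ℕ) (B : Block π) : ℕ :=
  ∑ j ∈ B.1, k j

lemma block_eq_iff {π : Finpartition (Finset.univ : Finset ι)} {j : ι} {B : Block π} :
    block π j = B ↔ j ∈ B.1 := by
  rw [← π.part_eq_iff_mem B.2, ← Subtype.coe_inj, block]

lemma block_surjective (π : Finpartition (Finset.univ : Finset ι)) :
    Function.Surjective (block π) := fun B =>
  (π.nonempty_of_mem_parts B.2).imp fun _ => block_eq_iff.2

lemma mem_parts_iff_exists_part_eq {π : Finpartition (Finset.univ : Finset ι)} {B : Finset ι} :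
    B ∈ π.parts ↔ ∃ j, π.part j = B := by
  constructor
  · intro hB
    obtain ⟨j, hj⟩ := block_surjective π ⟨B, hB⟩
    exact ⟨j, congrArg Subtype.val hj⟩
  · rintro ⟨j, rfl⟩
    exact (block π j).2

lemma eq_of_block_eq_iff {π ρ : Finpartition (Finset.univ : Finset ι)}
    (h : ∀ i j, block π i = block π j ↔ block ρ i = block ρ j) : π = ρ := by
  have part_eq (j : ι) : π.part j = ρ.part j := by
    ext i
    exact block_eq_iff.symm.trans ((h i j).trans block_eq_iff)
  ext B
  simp only [mem_parts_iff_exists_part_eq, part_eq]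

lemma part_bot (j : ι) : (⊥ : Finpartition (Finset.univ : Finset ι)).part j = {j} :=
  Finpartition.part_eq_of_mem ⊥ (Finpartition.mem_bot_iff.2 ⟨j, Finset.mem_univ j, rfl⟩)
    (Finset.mem_singleton_self j)

lemma block_bot_injective :
    Function.Injective (block (⊥ : Finpartition (Finset.univ : Finset ι))) := fun i j hij => by
  simpa only [block, part_bot, Subtype.mk.injEq, Finset.singleton_inj] using hij

/-- The points of `ι`, seen as the blocks of the discrete partition. -/
noncomputable def blockBotEquiv (ι : Type*) [Fintype ι] [DecidableEq ι] :
    ι ≃ Block (⊥ : Finpartition (Finset.univ : Finset ι)) :=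
  Equiv.ofBijective (block ⊥) ⟨block_bot_injective, block_surjective ⊥⟩

lemma card_block_lt_of_ne_bot {π : Finpartition (Finset.univ : Finset ι)} (hπ : π ≠ ⊥) :
    Fintype.card (Block π) < Fintype.card ι := by
  by_contra! hcard
  have hbij : Function.Bijective (block π) :=
    (Fintype.bijective_iff_surjective_and_card _).2
      ⟨block_surjective π, hcard.antisymm (Fintype.card_le_of_surjective _ (block_surjective π))⟩
  exact hπ (eq_of_block_eq_iff fun i j => by rw [hbij.1.eq_iff, block_bot_injective.eq_iff])

lemma blockSum_pos (π : Finpartition (Finset.univ : Finset ι)) {k : ι → ℕ} (hk : ∀ i, 0 < k i)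
    (B : Block π) : 0 < blockSum π k B :=
  Finset.sum_pos (fun j _ => hk j) (π.nonempty_of_mem_parts B.2)

lemma filter_block_eq (π : Finpartition (Finset.univ : Finset ι)) (B : Block π) :
    Finset.univ.filter (fun j => block π j = B) = B.1 := by
  ext j
  simp [block_eq_iff]

lemma prod_block_pow {M : Type*} [CommMonoid M] (π : Finpartition (Finset.univ : Finset ι))
    (y : Block π → M) (k : ι → ℕ) :
    ∏ j, y (block π j) ^ k j = ∏ B, y B ^ blockSum π k B := by
  rw [← Finset.prod_fiberwise Finset.univ (block π)]
  refine Finset.prod_congr rfl fun B _ => ?_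
  rw [filter_block_eq, blockSum, ← Finset.prod_pow_eq_pow_sum]
  exact Finset.prod_congr rfl fun j hj => by rw [block_eq_iff.2 hj]

lemma exists_finpartition_block_eq_iff {X : Type*} (f : ι → X) :
    ∃ π : Finpartition (Finset.univ : Finset ι), ∀ i j, block π i = block π j ↔ f i = f j := by
  classical
  refine ⟨Finpartition.ofSetoid (Setoid.ker f), fun i j => ?_⟩
  rw [block_eq_iff]
  exact Finpartition.mem_part_ofSetoid_iff_rel.trans eq_comm

/-- Every function factors uniquely through the partition into its level sets, followed by an
injection. -/
noncomputable def levelSetEquiv (ι X : Type*) [Fintype ι] [DecidableEq ι] :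
    (Σ π : Finpartition (Finset.univ : Finset ι), Block π ↪ X) ≃ (ι → X) :=
  Equiv.ofBijective (fun p j => p.2 (block p.1 j)) <| by
    constructor
    · rintro ⟨π, g⟩ ⟨ρ, h⟩ hgh
      obtain rfl : π = ρ := eq_of_block_eq_iff fun i j => by
        rw [← g.injective.eq_iff, ← h.injective.eq_iff]
        exact Eq.congr (congrFun hgh i) (congrFun hgh j)
      congr 1
      exact DFunLike.coe_injective ((block_surjective π).injective_comp_right hgh)
    · intro f
      obtain ⟨π, hπ⟩ := exists_finpartition_block_eq_iff f
      obtain ⟨σ, hσ⟩ := (block_surjective π).hasRightInverse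
      refine ⟨⟨π, f ∘ σ, fun B C hBC => ?_⟩, funext fun j => (hπ _ _).1 (hσ _)⟩
      rw [← hσ B, ← hσ C]
      exact (hπ _ _).2 hBC

lemma sum_eq_sum_finpartition {X R : Type*} [Fintype X] [AddCommMonoid R]
    (F : (ι → X) → R) :
    ∑ f, F f = ∑ π : Finpartition (Finset.univ : Finset ι),
      ∑ g : Block π ↪ X, F (fun j => g (block π j)) := by
  rw [← (levelSetEquiv ι X).sum_comp, Fintype.sum_sigma]
  rfl

end Blocks

section AugmentedMonomials

/-- The augmented monomial `∑ x_{g i}^{k i}`, the sum over all injections `g` of the index set. -/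
noncomputable def augSum {ι X R : Type*} [Fintype ι] [Fintype X] [CommSemiring R] (k : ι → ℕ)
    (x : X → R) : R :=
  ∑ g : ι ↪ X, ∏ i, x (g i) ^ k i

/-- The substitution `pₖ ↦ x₁ ^ k + ⋯ + x_N ^ k`. -/
noncomputable def toPoly (N : ℕ) : SymFun →ₐ[ℝ] MvPolynomial (Fin N) ℝ :=
  MvPolynomial.aeval (fun k : ℕ+ => MvPolynomial.psum (Fin N) ℝ (k : ℕ))

/-- The power sum `pₖ`, for `k > 0` (and `p₁` for `k = 0`). -/
noncomputable def powerSum (k : ℕ) : SymFun := MvPolynomial.X k.toPNat'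

/-- `f` is the augmented monomial symmetric function with exponents `k`, the sum of the monomials
`∏ x_{g i}^{k i}` over all injections `g` of the index set into the variables. -/
def IsAugmentedMonomial {ι : Type*} [Fintype ι] (k : ι → ℕ) (f : SymFun) : Prop :=
  ∀ N : ℕ, toPoly N f = augSum k (MvPolynomial.X : Fin N → MvPolynomial (Fin N) ℝ)

lemma toPoly_powerSum {k : ℕ} (hk : 0 < k) (N : ℕ) : toPoly N (powerSum k) =
    ∑ i : Fin N, (MvPolynomial.X i : MvPolynomial (Fin N) ℝ) ^ k := by
  rw [toPoly, powerSum, MvPolynomial.aeval_X, MvPolynomial.psum, Nat.toPNat'_coe, if_pos hk]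

section CommSemiring

variable {ι X R : Type*} [Fintype ι] [Fintype X] [CommSemiring R]

lemma prod_sum_pow_eq_sum_augSum [DecidableEq ι] (k : ι → ℕ) (x : X → R) :
    ∏ j, ∑ i, x i ^ k j = ∑ π : Finpartition (Finset.univ : Finset ι), augSum (blockSum π k) x := by
  rw [Finset.prod_univ_sum, Fintype.piFinset_univ, sum_eq_sum_finpartition]
  exact Finset.sum_congr rfl fun π _ => Finset.sum_congr rfl fun g _ =>
    prod_block_pow π (fun B => x (g B)) k

lemma augSum_comp_equiv {κ : Type*} [Fintype κ] (e : ι ≃ κ) (k : κ → ℕ)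
    (x : X → R) : augSum (k ∘ e) x = augSum k x :=
  Fintype.sum_equiv (Equiv.embeddingCongr e (Equiv.refl X)) _ _ fun g =>
    Fintype.prod_equiv e _ _ fun i => by simp

lemma augSum_blockSum_bot [DecidableEq ι] (k : ι → ℕ) (x : X → R) :
    augSum (blockSum ⊥ k) x = augSum k x := by
  have hk : blockSum ⊥ k ∘ blockBotEquiv ι = k := funext fun i => by
    change ∑ j ∈ (⊥ : Finpartition (Finset.univ : Finset ι)).part i, k j = k i
    rw [part_bot, Finset.sum_singleton]
  rw [← augSum_comp_equiv (blockBotEquiv ι), hk]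

end CommSemiring

lemma exists_isAugmentedMonomial {ι : Type*} [Fintype ι] (k : ι → ℕ) (hk : ∀ i, 0 < k i) :
    ∃ f, IsAugmentedMonomial k f := by
  classical
  induction hn : Fintype.card ι using Nat.strong_induction_on generalizing ι with
  | _ n ih =>
    have exists_of_ne_bot (π : Finpartition (Finset.univ : Finset ι)) :
        ∃ f, π ≠ ⊥ → IsAugmentedMonomial (blockSum π k) f := by
      by_cases hπ : π = ⊥
      · exact ⟨0, fun hne => absurd hπ hne⟩
      · obtain ⟨f, hf⟩ := ih _ (hn ▸ card_block_lt_of_ne_bot hπ) (blockSum π k)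
          (blockSum_pos π hk) rfl
        exact ⟨f, fun _ => hf⟩
    choose F hF using exists_of_ne_bot
    refine ⟨∏ j, powerSum (k j) - ∑ π ∈ Finset.univ.erase ⊥, F π, fun N => ?_⟩
    rw [map_sub, map_prod, map_sum, Finset.prod_congr rfl fun j _ => toPoly_powerSum (hk j) N,
      prod_sum_pow_eq_sum_augSum, ← Finset.add_sum_erase _ _ (Finset.mem_univ ⊥),
      augSum_blockSum_bot, add_sub_assoc, add_eq_left, sub_eq_zero]
    exact Finset.sum_congr rfl fun π hπ => (hF π (Finset.ne_of_mem_erase hπ) N).symm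

end AugmentedMonomials

section MonomialSymmetric

lemma count_map_univ {ι α : Type*} [Fintype ι] [DecidableEq α] (f : ι → α) (a : α) :
    (Finset.univ.val.map f).count a = Nat.card {i // f i = a} := by
  rw [Multiset.count_map, Nat.card_eq_fintype_card, Fintype.card_subtype, Finset.card_def,
    Finset.filter_val]
  simp only [eq_comm]

lemma exists_equiv_comp_eq {ι τ α : Type*} [Fintype ι] [Fintype τ] {f : ι → α} {g : τ → α}
    (h : Finset.univ.val.map f = Finset.univ.val.map g) : ∃ e : ι ≃ τ, g ∘ e = f := by
  classical
  have fiberEquiv (a : α) : Nonempty ({i // f i = a} ≃ {x // g x = a}) := by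
    rw [← Finite.card_eq, ← count_map_univ, ← count_map_univ, h]
  exact ⟨Equiv.ofFiberEquiv fun a => (fiberEquiv a).some, funext (Equiv.ofFiberEquiv_map _)⟩

/-- The product of the factorials of the multiplicities in `s`, the number of permutations of the
entries of a list underlying `s` that fix the list. -/
def symmetryFactor (s : Multiset ℕ) : ℕ := ∏ c ∈ s.toFinset, (s.count c).factorial

lemma card_perm_comp_eq {ι : Type*} [Fintype ι] [DecidableEq ι] (k : ι → ℕ) :
    Fintype.card {p : Equiv.Perm ι // k ∘ p = k} = symmetryFactor (Finset.univ.val.map k) := by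
  simp only [DomMulAct.stabilizer_card', symmetryFactor, count_map_univ, Nat.card_eq_fintype_card]
  rfl

variable {ι σ : Type*} [Fintype ι]

/-- The multiset that contains `g i` with multiplicity `k i`. -/
def weightedImage (k : ι → ℕ) (g : ι ↪ σ) : Multiset σ := ∑ i, k i • {g i}

lemma card_weightedImage (k : ι → ℕ) (g : ι ↪ σ) : (weightedImage k g).card = ∑ i, k i := by
  simp [weightedImage]

lemma prod_map_weightedImage {R : Type*} [CommSemiring R] (k : ι → ℕ) (g : ι ↪ σ) (x : σ → R) :
    ((weightedImage k g).map x).prod = ∏ i, x (g i) ^ k i := by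
  rw [weightedImage, ← Multiset.coe_mapAddMonoidHom, map_sum, Multiset.prod_sum]
  simp [Multiset.map_nsmul, Multiset.prod_nsmul]

lemma weightedImage_perm {k : ι → ℕ} {p : Equiv.Perm ι} (hp : k ∘ p = k) (g : ι ↪ σ) :
    weightedImage k (p.toEmbedding.trans g) = weightedImage k g := by
  refine Fintype.sum_equiv p _ _ fun i => ?_
  rw [← congrFun hp i]
  rfl

lemma mem_weightedImage {k : ι → ℕ} (hk : ∀ i, 0 < k i) {g : ι ↪ σ} {x : σ} :
    x ∈ weightedImage k g ↔ ∃ i, g i = x := by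
  simp [weightedImage, Multiset.mem_sum, Multiset.mem_nsmul, (hk _).ne', eq_comm]

section DecidableEq

variable [DecidableEq σ]

lemma count_weightedImage (k : ι → ℕ) (g : ι ↪ σ) (i : ι) :
    (weightedImage k g).count (g i) = k i := by
  classical
  simp [weightedImage, Multiset.count_sum', Multiset.count_singleton, g.injective.eq_iff]

lemma map_count_dedup_weightedImage {k : ι → ℕ} (hk : ∀ i, 0 < k i) (g : ι ↪ σ) :
    (weightedImage k g).dedup.map (weightedImage k g).count = Finset.univ.val.map k := by
  have hdedup : (weightedImage k g).dedup = Finset.univ.val.map g :=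
    (Multiset.Nodup.ext (Multiset.nodup_dedup _) (Finset.univ.nodup.map g.injective)).2 fun x => by
      simp [mem_weightedImage hk]
  rw [hdedup, Multiset.map_map]
  exact Multiset.map_congr rfl fun i _ => count_weightedImage k g i

lemma exists_weightedImage_eq {k : ι → ℕ} {s : Multiset σ}
    (hs : s.dedup.map s.count = Finset.univ.val.map k) : ∃ g : ι ↪ σ, weightedImage k g = s := by
  have hdedup : s.dedup = Finset.univ.val.map (Subtype.val : s.toFinset → σ) :=
    (congrArg Finset.val (Finset.attach_map_val (s := s.toFinset))).symm
  rw [hdedup, Multiset.map_map] at hs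
  obtain ⟨e, he⟩ := exists_equiv_comp_eq hs.symm
  refine ⟨e.toEmbedding.trans (Function.Embedding.subtype _), ?_⟩
  calc ∑ i, k i • ({(e i).1} : Multiset σ)
      = ∑ x : s.toFinset, s.count x.1 • {x.1} :=
        Fintype.sum_equiv e _ _ fun i => by rw [← congrFun he i]; rfl
    _ = s := (Finset.sum_coe_sort s.toFinset fun x => s.count x • ({x} : Multiset σ)).trans
        (Multiset.toFinset_sum_count_nsmul_eq s)

end DecidableEq

lemma exists_perm_trans_eq {k : ι → ℕ} (hk : ∀ i, 0 < k i) {g g₀ : ι ↪ σ}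
    (h : weightedImage k g = weightedImage k g₀) :
    ∃ p : Equiv.Perm ι, k ∘ p = k ∧ p.toEmbedding.trans g₀ = g := by
  classical
  have hrange (i : ι) : ∃ j, g₀ j = g i := by
    rw [← mem_weightedImage hk, ← h, mem_weightedImage hk]
    exact ⟨i, rfl⟩
  choose p hp using hrange
  have hinj : Function.Injective p := fun i j hij => g.injective (by rw [← hp, hij, hp])
  refine ⟨Equiv.ofBijective p (Finite.injective_iff_bijective.1 hinj), funext fun i => ?_,
    DFunLike.ext _ _ hp⟩
  change k (p i) = k i
  rw [← count_weightedImage k g₀, hp, ← h, count_weightedImage]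

lemma card_weightedImage_fiber {k : ι → ℕ} (hk : ∀ i, 0 < k i) (g₀ : ι ↪ σ) :
    Nat.card {g : ι ↪ σ // weightedImage k g = weightedImage k g₀} =
      symmetryFactor (Finset.univ.val.map k) := by
  classical
  rw [← card_perm_comp_eq, ← Nat.card_eq_fintype_card]
  refine (Nat.card_congr (Equiv.ofBijective (fun p : {p : Equiv.Perm ι // k ∘ p = k} =>
    (⟨p.1.toEmbedding.trans g₀, weightedImage_perm p.2 g₀⟩ :
      {g : ι ↪ σ // weightedImage k g = weightedImage k g₀})) ⟨?_, ?_⟩)).symm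
  · intro p q hpq
    ext i
    exact g₀.injective (DFunLike.congr_fun (congrArg Subtype.val hpq) i)
  · rintro ⟨g, hg⟩
    obtain ⟨p, hkp, rfl⟩ := exists_perm_trans_eq hk hg
    exact ⟨⟨p, hkp⟩, rfl⟩

lemma augSum_X_eq_smul_msymm {R : Type*} [CommSemiring R] [Fintype σ] [DecidableEq σ] {n : ℕ}
    {lam : n.Partition} {k : ι → ℕ} (hlam : Finset.univ.val.map k = lam.parts) :
    augSum k (MvPolynomial.X : σ → MvPolynomial σ R) =
      symmetryFactor lam.parts • MvPolynomial.msymm σ R lam := by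
  have hk (i : ι) : 0 < k i :=
    lam.parts_pos (hlam ▸ Multiset.mem_map_of_mem k (Finset.mem_univ i))
  have hsum : ∑ i, k i = n := by
    rw [Finset.sum_eq_multiset_sum, hlam, lam.parts_sum]
  let S (g : ι ↪ σ) : {a : Sym σ n // Nat.Partition.ofSym a = lam} :=
    ⟨⟨weightedImage k g, by rw [card_weightedImage, hsum]⟩,
      Nat.Partition.ext ((map_count_dedup_weightedImage hk g).trans hlam)⟩
  have S_eq_iff (g : ι ↪ σ) s : S g = s ↔ weightedImage k g = s.1.1 :=
    Subtype.ext_iff.trans Subtype.ext_iff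
  rw [augSum, MvPolynomial.msymm, ← Finset.sum_fiberwise Finset.univ S, Finset.smul_sum]
  refine Finset.sum_congr rfl fun s _ => ?_
  obtain ⟨g₀, hg₀⟩ := exists_weightedImage_eq (k := k) (s := s.1.1)
    ((congrArg Nat.Partition.parts s.2).trans hlam.symm)
  rw [← hlam, ← card_weightedImage_fiber hk g₀, hg₀, Nat.card_eq_fintype_card,
    Fintype.card_subtype, ← Finset.filter_congr fun g _ => S_eq_iff g s]
  refine Finset.sum_eq_card_nsmul fun g hg => ?_
  rw [← (S_eq_iff g s).1 (Finset.mem_filter.1 hg).2, prod_map_weightedImage]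

lemma symmetryFactor_pos (s : Multiset ℕ) : 0 < symmetryFactor s :=
  Finset.prod_pos fun _ _ => Nat.factorial_pos _

lemma isAugmentedMonomial_smul_iff {n : ℕ} {lam : n.Partition} {k : ι → ℕ}
    (hlam : Finset.univ.val.map k = lam.parts) {f : SymFun} :
    IsAugmentedMonomial k (symmetryFactor lam.parts • f) ↔ IsMonomialSymm lam f := by
  refine forall_congr' fun N => ?_
  rw [map_nsmul, augSum_X_eq_smul_msymm hlam, nsmul_right_inj (symmetryFactor_pos _).ne', toPoly]

end MonomialSymmetric

section KingmanDimension

/-- The multiset obtained from the multiset `s` of parts by lowering one part `k` to `k - 1`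
(removing it when `k = 1`). -/
def lowerPart (s : Multiset ℕ) (k : ℕ) : Multiset ℕ :=
  if k = 1 then s.erase k else (k - 1) ::ₘ s.erase k

lemma prod_factorial_eq_mul_lowerPart {s : Multiset ℕ} {k : ℕ} (hk : k ∈ s) (hpos : 0 < k) :
    (s.map Nat.factorial).prod = k * ((lowerPart s k).map Nat.factorial).prod := by
  conv_lhs => rw [← Multiset.cons_erase hk, Multiset.map_cons, Multiset.prod_cons]
  rw [lowerPart]
  split_ifs with h
  · rw [h, Nat.factorial_one]
  · rw [Multiset.map_cons, Multiset.prod_cons, ← mul_assoc, Nat.mul_factorial_pred hpos.ne']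

lemma sum_lowerPart_add_one {s : Multiset ℕ} {k : ℕ} (hk : k ∈ s) (hpos : 0 < k) :
    (lowerPart s k).sum + 1 = s.sum := by
  conv_rhs => rw [← Multiset.cons_erase hk, Multiset.sum_cons]
  rw [lowerPart]
  split_ifs with h
  · rw [h, add_comm]
  · rw [Multiset.sum_cons]
    omega

lemma pos_of_mem_lowerPart {s : Multiset ℕ} (hs : ∀ i ∈ s, 0 < i) {k i : ℕ} (hk : 0 < k)
    (hi : i ∈ lowerPart s k) : 0 < i := by
  rw [lowerPart] at hi
  split_ifs at hi with h
  · exact hs i (Multiset.mem_of_mem_erase hi)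
  · rcases Multiset.mem_cons.1 hi with rfl | hi
    · omega
    · exact hs i (Multiset.mem_of_mem_erase hi)

/-- The partition below `lam` in the Kingman graph obtained by lowering one part `k`. -/
def lowerPartition {n : ℕ} (lam : (n + 1).Partition) {k : ℕ} (hk : k ∈ lam.parts) :
    n.Partition where
  parts := lowerPart lam.parts k
  parts_pos := pos_of_mem_lowerPart (fun _ => lam.parts_pos) (lam.parts_pos hk)
  parts_sum := Nat.succ_injective <|
    (sum_lowerPart_add_one hk (lam.parts_pos hk)).trans lam.parts_sum

lemma dimKingman_succ {n : ℕ} (lam : (n + 1).Partition) :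
    dimKingman (n + 1) lam = ∑ k : lam.parts.toFinset,
      lam.parts.count k.1 * dimKingman n (lowerPartition lam (Multiset.mem_toFinset.1 k.2)) := by
  simp only [dimKingman, edgeMult, Finset.mul_sum]
  rw [Finset.sum_comm, ← Finset.sum_coe_sort]
  refine Finset.sum_congr rfl fun k _ => ?_
  rw [Finset.sum_eq_single (lowerPartition lam (Multiset.mem_toFinset.1 k.2))]
  · rw [if_pos (by rfl), mul_comm]
  · intro mu _ hmu
    rw [if_neg fun h => hmu (Nat.Partition.ext h.symm), mul_zero]
  · exact fun h => absurd (Finset.mem_univ _) h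

lemma dimKingman_mul_prod_factorial : ∀ (n : ℕ) (lam : n.Partition),
    dimKingman n lam * (lam.parts.map Nat.factorial).prod = n.factorial
  | 0, lam => by
    rw [Subsingleton.elim lam (Nat.Partition.indiscrete 0)]
    simp [dimKingman]
  | n + 1, lam => by
    calc dimKingman (n + 1) lam * (lam.parts.map Nat.factorial).prod
        = ∑ k : lam.parts.toFinset, lam.parts.count k.1 * k.1 * n.factorial := by
          rw [dimKingman_succ, Finset.sum_mul]
          refine Finset.sum_congr rfl fun k _ => ?_
          have hk := Multiset.mem_toFinset.1 k.2
          rw [prod_factorial_eq_mul_lowerPart hk (lam.parts_pos hk),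
            ← dimKingman_mul_prod_factorial n (lowerPartition lam hk)]
          simp only [lowerPartition]
          ring
      _ = (n + 1).factorial := by
          rw [← Finset.sum_mul, Finset.sum_coe_sort lam.parts.toFinset fun k =>
            lam.parts.count k * k, Nat.factorial_succ]
          congr 1
          simpa only [smul_eq_mul, lam.parts_sum] using
            (Finset.sum_multiset_count lam.parts).symm

end KingmanDimension

section Evaluation

lemma eval_toPoly {N : ℕ} (x : Fin N → ℝ) (f : SymFun) :
    MvPolynomial.eval x (toPoly N f) = MvPolynomial.eval (fun k : ℕ+ => ∑ i, x i ^ (k : ℕ)) f := by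
  have hcomp : (MvPolynomial.aeval x).comp (toPoly N) =
      MvPolynomial.aeval (R := ℝ) (fun k : ℕ+ => ∑ i, x i ^ (k : ℕ)) := by
    ext k
    simp [toPoly, MvPolynomial.psum]
  exact DFunLike.congr_fun hcomp f

lemma eval_toPoly_eq_augSum {ι : Type*} [Fintype ι] {k : ι → ℕ} {f : SymFun}
    (hf : IsAugmentedMonomial k f) {N : ℕ} (x : Fin N → ℝ) :
    MvPolynomial.eval x (toPoly N f) = augSum k x := by
  simp [hf N, augSum]

end Evaluation

section Simplex

lemma simplex.sum_range_le_one (α : simplex) (N : ℕ) : ∑ i ∈ Finset.range N, α.1 i ≤ 1 :=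
  (α.2.2.2.1.sum_le_tsum _ fun i _ => α.2.2.1 i).trans α.2.2.2.2

lemma simplex.apply_le_one (α : simplex) (i : ℕ) : α.1 i ≤ 1 :=
  (α.2.2.2.1.le_tsum i fun j _ => α.2.2.1 j).trans α.2.2.2.2

lemma simplex.summable_pow (α : simplex) {k : ℕ} (hk : 0 < k) : Summable fun i => α.1 i ^ k :=
  α.2.2.2.1.of_nonneg_of_le (fun i => pow_nonneg (α.2.2.1 i) k) fun i =>
    pow_le_of_le_one (α.2.2.1 i) (simplex.apply_le_one α i) hk.ne'

lemma extPowerSum_one (α : simplex) : extPowerSum α 1 = 1 := by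
  simp [extPowerSum, gam]

lemma extPowerSum_of_ne {k : ℕ+} (hk : k ≠ 1) (α : simplex) :
    extPowerSum α k = ∑' i, α.1 i ^ (k : ℕ) := if_neg hk

lemma two_le_of_ne_one {k : ℕ+} (hk : k ≠ 1) : 2 ≤ (k : ℕ) :=
  (one_le (a := k)).lt_of_ne' hk

lemma gam_nonneg (α : simplex) : 0 ≤ gam α := sub_nonneg.2 α.2.2.2.2

lemma extPowerSum_nonneg (α : simplex) (k : ℕ+) : 0 ≤ extPowerSum α k := by
  by_cases hk : k = 1
  · rw [hk, extPowerSum_one]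
    exact zero_le_one
  · rw [extPowerSum_of_ne hk]
    exact tsum_nonneg fun i => pow_nonneg (α.2.2.1 i) _

/-- Approximation of a point of the simplex by finite sequences of sum one: the mass that the first
`N` coordinates leave is spread evenly over `N + 1` points, so that only the first power sum sees
the defect in the limit. -/
noncomputable def finiteApprox (α : simplex) (N : ℕ) : Fin (N + (N + 1)) → ℝ :=
  Fin.append (fun i : Fin N => α.1 i)
    (fun _ : Fin (N + 1) => (1 - ∑ i ∈ Finset.range N, α.1 i) / (N + 1))

lemma sum_finiteApprox_pow (α : simplex) (N k : ℕ) :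
    ∑ i, finiteApprox α N i ^ k = ∑ i ∈ Finset.range N, α.1 i ^ k +
      (N + 1) * ((1 - ∑ i ∈ Finset.range N, α.1 i) / (N + 1)) ^ k := by
  rw [Fin.sum_univ_add]
  simp [finiteApprox, Fin.sum_univ_eq_sum_range (fun i => α.1 i ^ k)]

lemma sum_finiteApprox (α : simplex) (N : ℕ) : ∑ i, finiteApprox α N i = 1 := by
  have hsum := sum_finiteApprox_pow α N 1
  simp only [pow_one] at hsum
  rw [hsum, mul_div_cancel₀ _ (by positivity : (N : ℝ) + 1 ≠ 0), add_sub_cancel]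

lemma mul_div_pow_le {d : ℝ} (hd0 : 0 ≤ d) (hd1 : d ≤ 1) {k : ℕ} (hk : 2 ≤ k) (N : ℕ) :
    (N + 1) * (d / (N + 1)) ^ k ≤ 1 / ((N : ℝ) + 1) := by
  have hN : (1 : ℝ) ≤ N + 1 := by linarith [Nat.cast_nonneg (α := ℝ) N]
  calc (N + 1) * (d / (N + 1)) ^ k ≤ ((N : ℝ) + 1) * (1 / (N + 1)) ^ k := by gcongr
    _ ≤ (N + 1) * (1 / (N + 1)) ^ 2 := by
        gcongr ?_ * ?_
        exact pow_le_pow_of_le_one (by positivity) ((div_le_one (by positivity)).2 hN) hk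
    _ = 1 / (N + 1) := by field_simp

lemma tendsto_sum_finiteApprox_pow (α : simplex) (k : ℕ+) :
    Tendsto (fun N => ∑ i, finiteApprox α N i ^ (k : ℕ)) atTop (𝓝 (extPowerSum α k)) := by
  by_cases hk : k = 1
  · subst hk
    simp only [PNat.one_coe, pow_one, sum_finiteApprox, extPowerSum_one]
    exact tendsto_const_nhds
  · have hrest (N : ℕ) : 0 ≤ 1 - ∑ i ∈ Finset.range N, α.1 i :=
      sub_nonneg.2 (simplex.sum_range_le_one α N)
    simp only [sum_finiteApprox_pow]
    rw [extPowerSum_of_ne hk, ← add_zero (∑' i, α.1 i ^ (k : ℕ))]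
    refine (simplex.summable_pow α k.pos).hasSum.tendsto_sum_nat.add ?_
    refine squeeze_zero (fun N => ?_) (fun N => mul_div_pow_le (hrest N) ?_ (two_le_of_ne_one hk) N)
      tendsto_one_div_add_atTop_nhds_zero_nat
    · have := hrest N
      positivity
    · exact sub_le_self _ (Finset.sum_nonneg fun i _ => α.2.2.1 i)

lemma tendsto_eval_finiteApprox (α : simplex) (f : SymFun) :
    Tendsto (fun N => MvPolynomial.eval (finiteApprox α N) (toPoly _ f)) atTop
      (𝓝 (specialize α f)) := by
  simp only [eval_toPoly]
  exact ((MvPolynomial.continuous_eval f).tendsto _).comp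
    (tendsto_pi_nhds.2 (tendsto_sum_finiteApprox_pow α))

lemma specialize_congr {f g : SymFun} (h : ∀ N, toPoly N f = toPoly N g) (α : simplex) :
    specialize α f = specialize α g :=
  tendsto_nhds_unique (tendsto_eval_finiteApprox α f) <| by
    simpa only [h] using tendsto_eval_finiteApprox α g

lemma simplex_eq : simplex = {α | Antitone α} ∩ {α | ∀ i, 0 ≤ α i} ∩
    {α | ∀ N, ∑ i ∈ Finset.range N, α i ≤ 1} := by
  ext α
  constructor
  · exact fun hα => ⟨⟨hα.1, hα.2.1⟩, simplex.sum_range_le_one ⟨α, hα⟩⟩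
  · rintro ⟨⟨hanti, hnonneg⟩, hsum⟩
    have hs : Summable α := summable_of_sum_range_le hnonneg hsum
    exact ⟨hanti, hnonneg, hs, hs.tsum_le_of_sum_range_le hsum⟩

lemma isClosed_simplex : IsClosed simplex := by
  simp only [simplex_eq, Antitone, Set.ofPred_forall]
  refine (IsClosed.inter ?_ ?_).inter ?_
  · exact isClosed_iInter fun i => isClosed_iInter fun j => isClosed_iInter fun _ =>
      isClosed_le (continuous_apply j) (continuous_apply i)
  · exact isClosed_iInter fun i => isClosed_le continuous_const (continuous_apply i)
  · exact isClosed_iInter fun N => isClosed_le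
      (continuous_finsetSum _ fun i _ => continuous_apply i) continuous_const

instance compactSpace_simplex : CompactSpace simplex :=
  isCompact_iff_compactSpace.1 <| IsCompact.of_isClosed_subset
    (isCompact_univ_pi fun _ : ℕ => isCompact_Icc (a := (0 : ℝ)) (b := 1)) isClosed_simplex
    fun α hα i _ => ⟨hα.2.1 i, simplex.apply_le_one ⟨α, hα⟩ i⟩

instance polishSpace_simplex : PolishSpace simplex := isClosed_simplex.polishSpace

lemma simplex_apply_le (α : simplex) (i : ℕ) : α.1 i ≤ 1 / (i + 1) := by
  rw [le_div_iff₀ (by positivity)]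
  calc α.1 i * (i + 1) = ∑ _j ∈ Finset.range (i + 1), α.1 i := by simp [mul_comm]
    _ ≤ ∑ j ∈ Finset.range (i + 1), α.1 j := Finset.sum_le_sum fun j hj =>
        α.2.1 (Nat.lt_succ_iff.1 (Finset.mem_range.1 hj))
    _ ≤ 1 := simplex.sum_range_le_one α _

lemma continuous_tsum_pow {k : ℕ} (hk : 2 ≤ k) :
    Continuous fun α : simplex => ∑' i, α.1 i ^ k := by
  refine continuous_tsum (u := fun i : ℕ => (1 / ((i : ℝ) + 1)) ^ 2)
    (fun i => ((continuous_apply i).comp continuous_subtype_val).pow k) ?_ fun i α => ?_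
  · simpa using (summable_nat_add_iff 1).2 (Real.summable_one_div_nat_pow.2 one_lt_two)
  · rw [Real.norm_of_nonneg (pow_nonneg (α.2.2.1 i) k)]
    calc α.1 i ^ k ≤ α.1 i ^ 2 :=
          pow_le_pow_of_le_one (α.2.2.1 i) (simplex.apply_le_one α i) hk
      _ ≤ (1 / (i + 1)) ^ 2 := pow_le_pow_left₀ (α.2.2.1 i) (simplex_apply_le α i) 2

lemma continuous_extPowerSum (k : ℕ+) : Continuous fun α => extPowerSum α k := by
  by_cases hk : k = 1
  · subst hk
    simp only [extPowerSum_one]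
    exact continuous_const
  · simp only [extPowerSum_of_ne hk]
    exact continuous_tsum_pow (two_le_of_ne_one hk)

lemma continuous_specialize (f : SymFun) : Continuous fun α => specialize α f :=
  (MvPolynomial.continuous_eval f).comp (continuous_pi continuous_extPowerSum)

end Simplex

section PowerSumsDetermine

lemma le_of_forall_pow_le {a b : ℝ} (hb : 0 ≤ b) (h : ∀ j : ℕ, a ^ (j + 2) ≤ b ^ (j + 1)) :
    a ≤ b := by
  by_contra! hba
  have ha : 0 < a := hb.trans_lt hba
  have hlt : b / a < 1 := (div_lt_one ha).2 hba
  obtain ⟨j, hj⟩ := exists_pow_lt_of_lt_one ha hlt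
  have hj' : (b / a) ^ (j + 1) < a :=
    (pow_le_pow_of_le_one (by positivity) hlt.le (Nat.le_succ j)).trans_lt hj
  rw [div_pow, div_lt_iff₀ (by positivity), ← pow_succ'] at hj'
  exact (h j).not_gt hj'

lemma pow_le_tsum_tail_pow (α : simplex) (m : ℕ) {k : ℕ} (hk : 0 < k) :
    α.1 m ^ k ≤ ∑' i, α.1 (i + m) ^ k := by
  simpa only [zero_add] using
    ((summable_nat_add_iff m).2 (simplex.summable_pow α hk)).le_tsum 0
      fun i _ => pow_nonneg (α.2.2.1 (i + m)) k

lemma tsum_tail_pow_succ_le (α : simplex) (m k : ℕ) :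
    ∑' i, α.1 (i + m) ^ (k + 1) ≤ α.1 m ^ k := by
  have hsum := simplex.summable_pow α k.succ_pos
  have htail : ∑' i, α.1 (i + m) ≤ 1 := by
    refine le_trans ?_ α.2.2.2.2
    rw [← α.2.2.2.1.sum_add_tsum_nat_add m]
    exact le_add_of_nonneg_left (Finset.sum_nonneg fun i _ => α.2.2.1 i)
  calc ∑' i, α.1 (i + m) ^ (k + 1) ≤ ∑' i, α.1 m ^ k * α.1 (i + m) := by
        refine ((summable_nat_add_iff m).2 hsum).tsum_le_tsum (fun i => ?_)
          (((summable_nat_add_iff m).2 α.2.2.2.1).mul_left _)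
        rw [pow_succ]
        exact mul_le_mul_of_nonneg_right
          (pow_le_pow_left₀ (α.2.2.1 _) (α.2.1 (Nat.le_add_left m i)) _) (α.2.2.1 _)
    _ = α.1 m ^ k * ∑' i, α.1 (i + m) := tsum_mul_left
    _ ≤ α.1 m ^ k := mul_le_of_le_one_right (pow_nonneg (α.2.2.1 m) _) htail

lemma extPowerSum_add_two (α : simplex) (j : ℕ) :
    extPowerSum α (j + 1).succPNat = ∑' i, α.1 i ^ (j + 2) :=
  extPowerSum_of_ne (k := (j + 1).succPNat)
    (fun h => Nat.succ_succ_ne_one j (congrArg PNat.val h)) α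

lemma tsum_tail_pow_eq {α β : simplex} (h : extPowerSum α = extPowerSum β) {m : ℕ}
    (hm : ∀ i < m, α.1 i = β.1 i) (j : ℕ) :
    ∑' i, α.1 (i + m) ^ (j + 2) = ∑' i, β.1 (i + m) ^ (j + 2) := by
  have hj := congrFun h (j + 1).succPNat
  rw [extPowerSum_add_two, extPowerSum_add_two,
    ← (simplex.summable_pow α (j + 1).succ_pos).sum_add_tsum_nat_add m,
    ← (simplex.summable_pow β (j + 1).succ_pos).sum_add_tsum_nat_add m,
    Finset.sum_congr rfl fun i hi => by rw [hm i (Finset.mem_range.1 hi)]] at hj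
  exact add_left_cancel hj

lemma le_of_extPowerSum_eq {α β : simplex} (h : extPowerSum α = extPowerSum β) {m : ℕ}
    (hm : ∀ i < m, α.1 i = β.1 i) : α.1 m ≤ β.1 m :=
  le_of_forall_pow_le (β.2.2.1 m) fun j =>
    calc α.1 m ^ (j + 2) ≤ ∑' i, α.1 (i + m) ^ (j + 2) := pow_le_tsum_tail_pow α m (Nat.succ_pos _)
      _ = ∑' i, β.1 (i + m) ^ (j + 2) := tsum_tail_pow_eq h hm j
      _ ≤ β.1 m ^ (j + 1) := tsum_tail_pow_succ_le β m (j + 1)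

lemma injective_extPowerSum : Function.Injective extPowerSum := by
  intro α β h
  ext m
  induction m using Nat.strong_induction_on with
  | _ m ih =>
    exact le_antisymm (le_of_extPowerSum_eq h ih)
      (le_of_extPowerSum_eq h.symm fun i hi => (ih i hi).symm)

lemma isClosedEmbedding_extPowerSum : IsClosedEmbedding extPowerSum :=
  (continuous_pi continuous_extPowerSum).isClosedEmbedding injective_extPowerSum

end PowerSumsDetermine

section MomentProblem

variable {E σ : Type*} [TopologicalSpace E] [CompactSpace E] [MeasurableSpace E] [BorelSpace E]
  {μ ν : Measure E} [IsFiniteMeasure μ] [IsFiniteMeasure ν] {p : σ → E → ℝ}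

lemma integrable_of_continuous {f : E → ℝ} (hf : Continuous f) : Integrable f μ :=
  hf.integrable_of_hasCompactSupport (HasCompactSupport.of_compactSpace f)

lemma integral_eval_eq_of_integral_prod_eq (hp : ∀ i, Continuous (p i))
    (h : ∀ d : σ →₀ ℕ, ∫ x, d.prod (fun i n => p i x ^ n) ∂μ =
      ∫ x, d.prod (fun i n => p i x ^ n) ∂ν) (f : MvPolynomial σ ℝ) :
    ∫ x, MvPolynomial.eval (fun i => p i x) f ∂μ =
      ∫ x, MvPolynomial.eval (fun i => p i x) f ∂ν := by
  have hcont (d : σ →₀ ℕ) : Continuous fun x => f.coeff d * ∏ i ∈ d.support, p i x ^ d i :=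
    continuous_const.mul (continuous_finsetProd _ fun i _ => (hp i).pow _)
  simp only [MvPolynomial.eval_eq]
  rw [integral_finsetSum _ fun d _ => integrable_of_continuous (hcont d),
    integral_finsetSum _ fun d _ => integrable_of_continuous (hcont d)]
  exact Finset.sum_congr rfl fun d _ => by
    rw [integral_const_mul, integral_const_mul]
    exact congrArg _ (h d)

lemma ext_of_integral_finsuppProd_eq [PolishSpace E] (hp : ∀ i, Continuous (p i))
    (hsep : ∀ x y, (∀ i, p i x = p i y) → x = y)
    (h : ∀ d : σ →₀ ℕ, ∫ x, d.prod (fun i n => p i x ^ n) ∂μ =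
      ∫ x, d.prod (fun i n => p i x ^ n) ∂ν) : μ = ν := by
  let Φ : MvPolynomial σ ℝ →ₐ[ℝ] BoundedContinuousFunction E ℝ :=
    MvPolynomial.aeval fun i => BoundedContinuousFunction.mkOfCompact ⟨p i, hp i⟩
  have Φ_apply (f : MvPolynomial σ ℝ) (x : E) :
      Φ f x = MvPolynomial.eval (fun i => p i x) f := by
    induction f using MvPolynomial.induction_on with
    | C a => simp [Φ]
    | add f g hf hg => rw [map_add, BoundedContinuousFunction.add_apply, hf, hg, map_add]
    | mul_X f i hf =>
      rw [map_mul, BoundedContinuousFunction.mul_apply, hf]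
      simp [Φ]
  let A : StarSubalgebra ℝ (BoundedContinuousFunction E ℝ) :=
    { Φ.range with
      star_mem' := fun {a} ha => by
        have hstar : star a = a := BoundedContinuousFunction.ext fun _ => star_trivial _
        rwa [hstar] }
  refine ext_of_forall_mem_subalgebra_integral_eq_of_polish (𝕜 := ℝ) (A := A) ?_ ?_
  · intro x y hxy
    obtain ⟨i, hi⟩ : ∃ i, p i x ≠ p i y := by
      by_contra! hall
      exact hxy (hsep x y hall)
    refine ⟨_, ⟨_, ⟨Φ (MvPolynomial.X i), ⟨_, rfl⟩, rfl⟩, rfl⟩, ?_⟩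
    simpa [Φ_apply] using hi
  · rintro _ ⟨f, rfl⟩
    simpa [Φ_apply] using integral_eval_eq_of_integral_prod_eq hp h f

lemma ext_of_integral_prod_pow_eq {ι : Type*} [Fintype ι] {K : Set (ι → ℝ)} (hK : IsCompact K)
    {μ ν : Measure (ι → ℝ)} [IsFiniteMeasure μ] [IsFiniteMeasure ν] (hμ : ∀ᵐ x ∂μ, x ∈ K)
    (hν : ∀ᵐ x ∂ν, x ∈ K)
    (h : ∀ c : ι → ℕ, ∫ x, ∏ i, x i ^ c i ∂μ = ∫ x, ∏ i, x i ^ c i ∂ν) : μ = ν := by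
  have : CompactSpace K := isCompact_iff_compactSpace.1 hK
  have : PolishSpace K := hK.isClosed.polishSpace
  have integral_comap {ρ : Measure (ι → ℝ)} (hρ : ∀ᵐ x ∂ρ, x ∈ K) (c : ι → ℕ) :
      ∫ x : K, ∏ i, x.1 i ^ c i ∂ρ.comap (↑) = ∫ x, ∏ i, x i ^ c i ∂ρ := by
    rw [integral_subtype_comap hK.measurableSet fun x : ι → ℝ => ∏ i, x i ^ c i,
      Measure.restrict_eq_self_of_ae_mem hρ]
  have hcomap : μ.comap ((↑) : K → ι → ℝ) = ν.comap (↑) := by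
    refine ext_of_integral_finsuppProd_eq (p := fun i x => x.1 i)
      (fun i => (continuous_apply i).comp continuous_subtype_val)
      (fun x y hxy => Subtype.ext (funext hxy)) fun d => ?_
    simp only [Finsupp.prod_fintype _ _ fun _ => pow_zero _]
    rw [integral_comap hμ, integral_comap hν, h d]
  rw [← Measure.restrict_eq_self_of_ae_mem hμ, ← Measure.restrict_eq_self_of_ae_mem hν,
    ← map_comap_subtype_coe hK.measurableSet, ← map_comap_subtype_coe hK.measurableSet, hcomap]

end MomentProblem

section Moments

/-- The moments of the Poisson--Dirichlet distribution at augmented monomials. All exponents are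
meant to be positive, so that `k i - 1` is a true subtraction. -/
noncomputable def augMoment {ι : Type*} [Fintype ι] (t : ℝ) (k : ι → ℕ) : ℝ :=
  t ^ Fintype.card ι * (∏ i, ((k i - 1).factorial : ℝ)) / (ascPochhammer ℝ (∑ i, k i)).eval t

variable {ι : Type*} [Fintype ι] {t : ℝ} {P : Measure simplex}

lemma dimKingman_ne_zero {n : ℕ} (lam : n.Partition) : dimKingman n lam ≠ 0 := fun h =>
  n.factorial_ne_zero (by rw [← dimKingman_mul_prod_factorial n lam, h, zero_mul])

lemma prod_factorial_eq_prod_mul {k : ι → ℕ} (hk : ∀ i, 0 < k i) :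
    ∏ i, (k i).factorial = (∏ i, k i) * ∏ i, (k i - 1).factorial := by
  rw [← Finset.prod_mul_distrib]
  exact Finset.prod_congr rfl fun i _ => (Nat.mul_factorial_pred (hk i).ne').symm

lemma ewens_div_dimKingman_mul_symmetryFactor {n : ℕ} {lam : n.Partition} {k : ι → ℕ}
    (hlam : Finset.univ.val.map k = lam.parts) :
    ewens t lam / dimKingman n lam * symmetryFactor lam.parts = augMoment t k := by
  have hk (i : ι) : 0 < k i :=
    lam.parts_pos (hlam ▸ Multiset.mem_map_of_mem k (Finset.mem_univ i))
  have hsum : ∑ i, k i = n := by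
    rw [Finset.sum_eq_multiset_sum, hlam, lam.parts_sum]
  have hcard : lam.parts.card = Fintype.card ι := by
    rw [← hlam, Multiset.card_map, ← Finset.card_def, Finset.card_univ]
  have hzee : zee lam = (∏ i, k i) * symmetryFactor lam.parts := by
    rw [Finset.prod_eq_multiset_prod, hlam, zee, symmetryFactor]
  have hfactorial : n.factorial =
      dimKingman n lam * ((∏ i, k i) * ∏ i, (k i - 1).factorial) := by
    rw [← dimKingman_mul_prod_factorial n lam, ← prod_factorial_eq_prod_mul hk, ← hlam,
      Multiset.map_map]
    rfl
  have hdim : (dimKingman n lam : ℝ) ≠ 0 := mod_cast dimKingman_ne_zero lam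
  have hsymm : (symmetryFactor lam.parts : ℝ) ≠ 0 := mod_cast (symmetryFactor_pos _).ne'
  have hprod : (∏ i, (k i : ℝ)) ≠ 0 :=
    Finset.prod_ne_zero_iff.2 fun i _ => mod_cast (hk i).ne'
  rw [augMoment, hsum, ewens, hcard, hzee, hfactorial]
  push_cast
  by_cases hpoch : (ascPochhammer ℝ n).eval t = 0
  · simp [hpoch]
  · field_simp

lemma specialize_nsmul (α : simplex) (c : ℕ) (f : SymFun) :
    specialize α (c • f) = c * specialize α f := by
  rw [specialize, map_nsmul, nsmul_eq_mul, specialize]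

lemma integral_smul_eq_augMoment_iff {n : ℕ} {lam : n.Partition} {k : ι → ℕ}
    (hlam : Finset.univ.val.map k = lam.parts) (f : SymFun) :
    ∫ α, specialize α (symmetryFactor lam.parts • f) ∂P = augMoment t k ↔
      ∫ α, specialize α f ∂P = ewens t lam / dimKingman n lam := by
  have hsymm : (symmetryFactor lam.parts : ℝ) ≠ 0 := mod_cast (symmetryFactor_pos _).ne'
  simp only [specialize_nsmul, integral_const_mul]
  rw [← ewens_div_dimKingman_mul_symmetryFactor hlam, mul_comm, mul_left_inj' hsymm]

/-- The partition with parts `k i`. -/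
def partitionOf (k : ι → ℕ) (hk : ∀ i, 0 < k i) : (∑ i, k i).Partition where
  parts := Finset.univ.val.map k
  parts_pos hi := by
    obtain ⟨j, -, rfl⟩ := Multiset.mem_map.1 hi
    exact hk j
  parts_sum := rfl

lemma IsPoissonDirichlet.integral_augmentedMonomial (hP : IsPoissonDirichlet t P) {k : ι → ℕ}
    (hk : ∀ i, 0 < k i) {f : SymFun} (hf : IsAugmentedMonomial k f) :
    ∫ α, specialize α f ∂P = augMoment t k := by
  let lam := partitionOf k hk
  have hlam : Finset.univ.val.map k = lam.parts := rfl
  obtain ⟨m, rfl⟩ : ∃ m, symmetryFactor lam.parts • m = f :=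
    ⟨(symmetryFactor lam.parts : ℝ)⁻¹ • f, by
      rw [← Nat.cast_smul_eq_nsmul ℝ, smul_inv_smul₀ (mod_cast (symmetryFactor_pos _).ne')]⟩
  exact (integral_smul_eq_augMoment_iff hlam m).2
    (hP.integral_monomial _ lam m ((isAugmentedMonomial_smul_iff hlam).1 hf))

lemma isPoissonDirichlet_of_integral_augmentedMonomial [IsProbabilityMeasure P]
    (h : ∀ (n : ℕ) (k : Fin n → ℕ) (f : SymFun), (∀ i, 0 < k i) → IsAugmentedMonomial k f →
      ∫ α, specialize α f ∂P = augMoment t k) : IsPoissonDirichlet t P := by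
  refine ⟨inferInstance, fun n lam m hm => ?_⟩
  obtain ⟨l, hl⟩ : ∃ l : List ℕ, (l : Multiset ℕ) = lam.parts := Quot.exists_rep lam.parts
  have hlam : Finset.univ.val.map l.get = lam.parts := by
    rw [← hl]
    simp [Fin.univ_val_map]
  have hpos (i : Fin l.length) : 0 < l.get i :=
    lam.parts_pos (hlam ▸ Multiset.mem_map_of_mem l.get (Finset.mem_univ i))
  exact (integral_smul_eq_augMoment_iff hlam m).1
    (h _ _ _ hpos ((isAugmentedMonomial_smul_iff hlam).2 hm))

lemma specialize_prod_powerSum (α : simplex) (k : ι → ℕ) :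
    specialize α (∏ j, powerSum (k j)) = ∏ j, extPowerSum α (k j).toPNat' := by
  simp [specialize, powerSum]

lemma IsPoissonDirichlet.integral_prod_extPowerSum [DecidableEq ι] (hP : IsPoissonDirichlet t P)
    {k : ι → ℕ} (hk : ∀ i, 0 < k i) :
    ∫ α, ∏ j, extPowerSum α (k j).toPNat' ∂P =
      ∑ π : Finpartition (Finset.univ : Finset ι), augMoment t (blockSum π k) := by
  have := hP.isProbabilityMeasure
  choose F hF using fun π : Finpartition (Finset.univ : Finset ι) =>
    exists_isAugmentedMonomial (blockSum π k) (blockSum_pos π hk)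
  have expand (N : ℕ) : toPoly N (∏ j, powerSum (k j)) = toPoly N (∑ π, F π) := by
    simp only [map_prod, toPoly_powerSum (hk _), map_sum, hF _ N, prod_sum_pow_eq_sum_augSum]
  calc ∫ α, ∏ j, extPowerSum α (k j).toPNat' ∂P
      = ∫ α, ∑ π, specialize α (F π) ∂P := by
        simp only [← specialize_prod_powerSum, specialize_congr expand]
        simp only [specialize, map_sum]
    _ = ∑ π, ∫ α, specialize α (F π) ∂P :=
        integral_finsetSum _ fun π _ => integrable_of_continuous (continuous_specialize (F π))
    _ = ∑ π, augMoment t (blockSum π k) := Finset.sum_congr rfl fun π _ =>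
        hP.integral_augmentedMonomial (blockSum_pos π hk) (hF π)

lemma IsPoissonDirichlet.unique {Q : Measure simplex} (hP : IsPoissonDirichlet t P)
    (hQ : IsPoissonDirichlet t Q) : P = Q := by
  classical
  have := hP.isProbabilityMeasure
  have := hQ.isProbabilityMeasure
  refine ext_of_integral_finsuppProd_eq continuous_extPowerSum
    (fun α β h => injective_extPowerSum (funext h)) fun d => ?_
  let k (j : Σ i : d.support, Fin (d i)) : ℕ := j.1.1
  have prod_eq (α : simplex) :
      d.prod (fun i n => extPowerSum α i ^ n) = ∏ j, extPowerSum α (k j).toPNat' := by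
    simp only [k, Fintype.prod_sigma, PNat.coe_toPNat', Finset.prod_const, Finset.card_univ,
      Fintype.card_fin]
    exact (Finset.prod_coe_sort d.support fun i => extPowerSum α i ^ d i).symm
  simp only [prod_eq]
  rw [hP.integral_prod_extPowerSum fun j => j.1.1.pos,
    hQ.integral_prod_extPowerSum fun j => j.1.1.pos]

end Moments

section DirichletIntegrals

open ProbabilityTheory (beta)

lemma lintegral_Ioo_zero_one_rpow_mul_rpow {a b : ℝ} (ha : 0 < a) (hb : 0 < b) :
    ∫⁻ x in Set.Ioo (0 : ℝ) 1, ENNReal.ofReal (x ^ (a - 1) * (1 - x) ^ (b - 1)) =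
      ENNReal.ofReal (beta a b) := by
  have hpos := ProbabilityTheory.beta_pos ha hb
  have hpdf := ProbabilityTheory.lintegral_betaPDF_eq_one ha hb
  simp only [ProbabilityTheory.lintegral_betaPDF, mul_assoc,
    ENNReal.ofReal_mul (one_div_nonneg.2 hpos.le)] at hpdf
  rw [lintegral_const_mul' _ _ ENNReal.ofReal_ne_top] at hpdf
  rw [← mul_one (ENNReal.ofReal (beta a b)), ← hpdf, ← mul_assoc, ← ENNReal.ofReal_mul hpos.le,
    mul_one_div_cancel hpos.ne', ENNReal.ofReal_one, one_mul]

lemma lintegral_Ioo_rpow_mul_rpow {a b c : ℝ} (ha : 0 < a) (hb : 0 < b) (hc : 0 < c) :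
    ∫⁻ y in Set.Ioo 0 c, ENNReal.ofReal (y ^ (a - 1) * (c - y) ^ (b - 1)) =
      ENNReal.ofReal (beta a b * c ^ (a + b - 1)) := by
  have himage : (c * ·) '' Set.Ioo 0 1 = Set.Ioo 0 c := by
    rw [Set.image_mul_left_Ioo hc, mul_zero, mul_one]
  rw [← himage, lintegral_image_eq_lintegral_abs_deriv_mul measurableSet_Ioo
    (fun x _ => (hasDerivAt_const_mul c).hasDerivWithinAt)
    (mul_right_injective₀ hc.ne').injOn, mul_comm (beta a b),
    ENNReal.ofReal_mul (Real.rpow_nonneg hc.le _), ← lintegral_Ioo_zero_one_rpow_mul_rpow ha hb,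
    ← lintegral_const_mul' _ _ ENNReal.ofReal_ne_top]
  refine setLIntegral_congr_fun measurableSet_Ioo fun x hx => ?_
  have hx' : 0 ≤ 1 - x := sub_nonneg.2 hx.2.le
  have hpow : c ^ (a + b - 1) = c * (c ^ (a - 1) * c ^ (b - 1)) := by
    rw [show a + b - 1 = 1 + (a - 1 + (b - 1)) by ring, Real.rpow_add hc, Real.rpow_add hc,
      Real.rpow_one]
  rw [abs_of_pos hc, ← ENNReal.ofReal_mul hc.le, ← ENNReal.ofReal_mul (Real.rpow_nonneg hc.le _),
    hpow, ← mul_one_sub, Real.mul_rpow hc.le hx.1.le, Real.mul_rpow hc.le hx']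
  ring_nf

lemma posPow_of_pos {u : ℝ} (hu : 0 < u) (s : ℝ) : posPow u s = u ^ s := if_pos hu

lemma posPow_of_nonpos {u : ℝ} (hu : u ≤ 0) (s : ℝ) : posPow u s = 0 := if_neg hu.not_gt

lemma posPow_nonneg (u s : ℝ) : 0 ≤ posPow u s := by
  rw [posPow]
  split_ifs with hu
  exacts [Real.rpow_nonneg hu.le s, le_rfl]

@[fun_prop]
lemma measurable_posPow (s : ℝ) : Measurable fun u => posPow u s :=
  Measurable.ite measurableSet_Ioi (by fun_prop) measurable_const

lemma lintegral_Icc_rpow_mul_posPow {a b c : ℝ} (ha : 0 < a) (hb : 0 < b) (hc : c ≤ 1) :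
    ∫⁻ y in Set.Icc (0 : ℝ) 1, ENNReal.ofReal (y ^ (a - 1) * posPow (c - y) (b - 1)) =
      ENNReal.ofReal (beta a b * posPow c (a + b - 1)) := by
  have hvanish {y : ℝ} (hy : c ≤ y) :
      ENNReal.ofReal (y ^ (a - 1) * posPow (c - y) (b - 1)) = 0 := by
    rw [posPow_of_nonpos (sub_nonpos.2 hy), mul_zero, ENNReal.ofReal_zero]
  rw [setLIntegral_congr Ioc_ae_eq_Icc.symm]
  rcases le_or_gt c 0 with hc0 | hc0
  · rw [posPow_of_nonpos hc0, mul_zero, ENNReal.ofReal_zero]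
    exact (setLIntegral_congr_fun measurableSet_Ioc fun y hy => hvanish (hc0.trans hy.1.le)).trans
      lintegral_zero
  · have hsub : Set.Ioo 0 c ⊆ Set.Ioc 0 1 := fun y hy => ⟨hy.1, hy.2.le.trans hc⟩
    have hrest : ∫⁻ y in Set.Ioc 0 1 \ Set.Ioo 0 c,
        ENNReal.ofReal (y ^ (a - 1) * posPow (c - y) (b - 1)) = 0 :=
      (setLIntegral_congr_fun (measurableSet_Ioc.diff measurableSet_Ioo) fun y hy =>
        hvanish (not_lt.1 fun hyc => hy.2 ⟨hy.1.1, hyc⟩)).trans lintegral_zero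
    rw [← lintegral_inter_add_sdiff _ _ measurableSet_Ioo, Set.inter_eq_right.2 hsub, hrest,
      add_zero, posPow_of_pos hc0, ← lintegral_Ioo_rpow_mul_rpow ha hb hc0]
    exact setLIntegral_congr_fun measurableSet_Ioo fun y hy => by
      rw [posPow_of_pos (sub_pos.2 hy.2)]

/-- The unnormalized density on `[0,1]ʳ` of the Dirichlet distribution with parameters `a` and `s`,
in which the last coordinate, of parameter `s`, is `1 - ∑ yᵢ`. -/
noncomputable def dirichletWeight {r : ℕ} (a : Fin r → ℝ) (s : ℝ) (y : Fin r → ℝ) : ℝ :=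
  (∏ i, y i ^ (a i - 1)) * posPow (1 - ∑ i, y i) (s - 1)

@[fun_prop]
lemma measurable_dirichletWeight {r : ℕ} (a : Fin r → ℝ) (s : ℝ) :
    Measurable (dirichletWeight a s) := by
  unfold dirichletWeight
  fun_prop

lemma dirichletWeight_cons {r : ℕ} (a : Fin (r + 1) → ℝ) (s x : ℝ) (y : Fin r → ℝ) :
    dirichletWeight a s (Fin.cons x y) = (∏ i, y i ^ (a i.succ - 1)) *
      (x ^ (a 0 - 1) * posPow (1 - ∑ i, y i - x) (s - 1)) := by
  rw [dirichletWeight, Fin.prod_univ_succ, Fin.sum_univ_succ]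
  simp only [Fin.cons_zero, Fin.cons_succ]
  rw [sub_add_eq_sub_sub_swap]
  ring

lemma lintegral_dirichletWeight_cons {r : ℕ} {a : Fin (r + 1) → ℝ} {s : ℝ} (ha : 0 < a 0)
    (hs : 0 < s) {y : Fin r → ℝ} (hy : 0 ≤ y) :
    ∫⁻ x in Set.Icc (0 : ℝ) 1, ENNReal.ofReal (dirichletWeight a s (Fin.cons x y)) =
      ENNReal.ofReal (beta (a 0) s) *
        ENNReal.ofReal (dirichletWeight (fun i => a i.succ) (a 0 + s) y) := by
  have hprod : 0 ≤ ∏ i, y i ^ (a i.succ - 1) :=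
    Finset.prod_nonneg fun i _ => Real.rpow_nonneg (hy i) _
  have hle : 1 - ∑ i, y i ≤ 1 := sub_le_self _ (Finset.sum_nonneg fun i _ => hy i)
  simp only [dirichletWeight_cons, ENNReal.ofReal_mul hprod]
  rw [lintegral_const_mul' _ _ ENNReal.ofReal_ne_top, lintegral_Icc_rpow_mul_posPow ha hs hle,
    ENNReal.ofReal_mul (ProbabilityTheory.beta_pos ha hs).le, dirichletWeight,
    ENNReal.ofReal_mul hprod, mul_left_comm]

lemma volume_restrict_Icc_pi (r : ℕ) :
    (volume : Measure (Fin r → ℝ)).restrict (Set.Icc 0 1) =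
      Measure.pi fun _ : Fin r => (volume : Measure ℝ).restrict (Set.Icc 0 1) := by
  rw [← Set.pi_univ_Icc, volume_pi, Measure.restrict_pi_pi]
  rfl

lemma lintegral_Icc_cons {r : ℕ} {f : (Fin (r + 1) → ℝ) → ENNReal} (hf : Measurable f) :
    ∫⁻ y in Set.Icc 0 1, f y =
      ∫⁻ y in Set.Icc (0 : Fin r → ℝ) 1, ∫⁻ x in Set.Icc (0 : ℝ) 1, f (Fin.cons x y) := by
  have hmp := (measurePreserving_piFinSuccAbove
    (fun _ : Fin (r + 1) => (volume : Measure ℝ).restrict (Set.Icc 0 1)) 0).symm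
  rw [volume_restrict_Icc_pi, volume_restrict_Icc_pi, ← hmp.lintegral_comp hf]
  refine (lintegral_prod_symm _ (hf.comp hmp.measurable).aemeasurable).trans ?_
  refine lintegral_congr fun y => lintegral_congr fun x => congrArg f ?_
  exact Fin.insertNth_zero' x y

lemma lintegral_dirichletWeight {r : ℕ} {a : Fin r → ℝ} (ha : ∀ i, 0 < a i) {s : ℝ} (hs : 0 < s) :
    ∫⁻ y in Set.Icc 0 1, ENNReal.ofReal (dirichletWeight a s y) =
      ENNReal.ofReal ((∏ i, Real.Gamma (a i)) * Real.Gamma s / Real.Gamma (∑ i, a i + s)) := by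
  induction r generalizing s with
  | zero =>
    have hΓ := (Real.Gamma_pos_of_pos hs).ne'
    rw [volume_restrict_Icc_pi, Measure.pi_of_empty, lintegral_dirac]
    simp [dirichletWeight, posPow, hΓ]
  | succ r ih =>
    have hβ := ProbabilityTheory.beta_pos (ha 0) hs
    have hΓ := (Real.Gamma_pos_of_pos (add_pos (ha 0) hs)).ne'
    calc ∫⁻ y in Set.Icc 0 1, ENNReal.ofReal (dirichletWeight a s y)
      _ = ∫⁻ y in Set.Icc 0 1, ENNReal.ofReal (beta (a 0) s) *
            ENNReal.ofReal (dirichletWeight (fun i => a i.succ) (a 0 + s) y) := by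
          rw [lintegral_Icc_cons (by fun_prop)]
          exact setLIntegral_congr_fun measurableSet_Icc fun y hy =>
            lintegral_dirichletWeight_cons (ha 0) hs hy.1
      _ = _ := by
          rw [lintegral_const_mul' _ _ ENNReal.ofReal_ne_top,
            ih (fun i => ha i.succ) (add_pos (ha 0) hs), ← ENNReal.ofReal_mul hβ.le, beta,
            Fin.prod_univ_succ, Fin.sum_univ_succ, add_left_comm, ← add_assoc]
          field_simp

lemma ascPochhammer_eval_eq_Gamma_div {t : ℝ} (ht : 0 < t) (n : ℕ) :
    (ascPochhammer ℝ n).eval t = Real.Gamma (t + n) / Real.Gamma t := by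
  rw [eq_div_iff (Real.Gamma_pos_of_pos ht).ne']
  induction n with
  | zero => simp
  | succ n ih =>
    rw [ascPochhammer_succ_eval, mul_right_comm, ih, mul_comm, Nat.cast_succ, ← add_assoc,
      Real.Gamma_add_one (by positivity)]

end DirichletIntegrals

section DirichletMoments

lemma pow_mul_rpow_sub_one {x a : ℝ} (hx : 0 ≤ x) (ha : 0 < a) (c : ℕ) :
    x ^ c * x ^ (a - 1) = x ^ (a + c - 1) := by
  rcases c.eq_zero_or_pos with rfl | hc
  · simp
  · have hc' : (1 : ℝ) ≤ c := Nat.one_le_cast.2 hc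
    rw [mul_comm, add_sub_right_comm, Real.rpow_add_natCast' hx (by linarith)]

lemma pow_mul_posPow_sub_one (u s : ℝ) (c : ℕ) :
    u ^ c * posPow u (s - 1) = posPow u (s + c - 1) := by
  rcases lt_or_ge 0 u with hu | hu
  · rw [posPow_of_pos hu, posPow_of_pos hu, mul_comm, add_sub_right_comm,
      Real.rpow_add_natCast hu.ne']
  · rw [posPow_of_nonpos hu, posPow_of_nonpos hu, mul_zero]

lemma dirichletWeight_nonneg {r : ℕ} (a : Fin r → ℝ) (s : ℝ) {y : Fin r → ℝ} (hy : 0 ≤ y) :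
    0 ≤ dirichletWeight a s y :=
  mul_nonneg (Finset.prod_nonneg fun i _ => Real.rpow_nonneg (hy i) _) (posPow_nonneg _ _)

lemma dirichletWeight_mul_prod_pow {r : ℕ} {a : Fin r → ℝ} (ha : ∀ i, 0 < a i) (s : ℝ)
    (c : Fin r → ℕ) (d : ℕ) {y : Fin r → ℝ} (hy : 0 ≤ y) :
    dirichletWeight a s y * ((1 - ∑ i, y i) ^ d * ∏ i, y i ^ c i) =
      dirichletWeight (fun i => a i + c i) (s + d) y := by
  rw [dirichletWeight, dirichletWeight, ← pow_mul_posPow_sub_one,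
    ← Finset.prod_congr rfl fun i _ => pow_mul_rpow_sub_one (hy i) (ha i) (c i),
    Finset.prod_mul_distrib]
  ring

lemma lintegral_dirichletWeight_mul_prod_pow {r : ℕ} {a : Fin r → ℝ} (ha : ∀ i, 0 < a i) {s : ℝ}
    (hs : 0 < s) (c : Fin r → ℕ) (d : ℕ) :
    ∫⁻ y in Set.Icc 0 1, ENNReal.ofReal (dirichletWeight a s y) *
        ENNReal.ofReal ((1 - ∑ i, y i) ^ d * ∏ i, y i ^ c i) =
      ENNReal.ofReal ((∏ i, Real.Gamma (a i + c i)) * Real.Gamma (s + d) /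
        Real.Gamma (∑ i, (a i + c i) + (s + d))) := by
  rw [← lintegral_dirichletWeight (fun i => add_pos_of_pos_of_nonneg (ha i) (c i).cast_nonneg)
    (add_pos_of_pos_of_nonneg hs d.cast_nonneg)]
  refine setLIntegral_congr_fun measurableSet_Icc fun y hy => ?_
  rw [← dirichletWeight_mul_prod_pow ha s c d hy.1,
    ENNReal.ofReal_mul (dirichletWeight_nonneg a s hy.1)]

end DirichletMoments

section DirichletMeasure

/-- The point of the hyperplane `∑ xᵢ = 1` whose coordinates other than the first are `y`. -/
def simplexPoint {N : ℕ} (y : Fin N → ℝ) : Fin (N + 1) → ℝ :=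
  Fin.cons (1 - ∑ i, y i) y

@[fun_prop]
lemma measurable_simplexPoint {N : ℕ} : Measurable (simplexPoint (N := N)) := by
  refine measurable_pi_iff.2 fun j => ?_
  refine j.cases ?_ fun i => ?_
  · simp only [simplexPoint, Fin.cons_zero]
    fun_prop
  · simp only [simplexPoint, Fin.cons_succ]
    fun_prop

/-- The Dirichlet distribution with parameters `a₀, …, a_N`, on the simplex `x₀ + ⋯ + x_N = 1`
parametrized by `x₁, …, x_N`. -/
noncomputable def dirichletMeasure {N : ℕ} (a : Fin (N + 1) → ℝ) : Measure (Fin (N + 1) → ℝ) :=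
  ((volume.restrict (Set.Icc 0 1)).withDensity fun y =>
    ENNReal.ofReal (Real.Gamma (∑ j, a j) / ∏ j, Real.Gamma (a j)) *
      ENNReal.ofReal (dirichletWeight (fun i => a i.succ) (a 0) y)).map simplexPoint

lemma simplexPoint_mem_stdSimplex {N : ℕ} {y : Fin N → ℝ} (hy : 0 ≤ y) (hsum : ∑ i, y i ≤ 1) :
    simplexPoint y ∈ stdSimplex ℝ (Fin (N + 1)) := by
  refine ⟨fun j => j.cases (sub_nonneg.2 hsum) hy, ?_⟩
  rw [Fin.sum_univ_succ]
  simp [simplexPoint]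

lemma ae_dirichletMeasure_mem_stdSimplex {N : ℕ} (a : Fin (N + 1) → ℝ) :
    ∀ᵐ x ∂dirichletMeasure a, x ∈ stdSimplex ℝ (Fin (N + 1)) := by
  have hmeas : MeasurableSet (stdSimplex ℝ (Fin (N + 1))) := (isClosed_stdSimplex ℝ _).measurableSet
  refine (ae_map_iff measurable_simplexPoint.aemeasurable hmeas).2
    ((ae_withDensity_iff (by fun_prop)).2 ?_)
  filter_upwards [ae_restrict_mem measurableSet_Icc] with y hy hne
  refine simplexPoint_mem_stdSimplex hy.1 (not_lt.1 fun hsum => hne ?_)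
  rw [dirichletWeight, posPow_of_nonpos (sub_nonpos.2 hsum.le), mul_zero, ENNReal.ofReal_zero,
    mul_zero]

lemma lintegral_prod_pow_dirichletMeasure {N : ℕ} {a : Fin (N + 1) → ℝ} (ha : ∀ j, 0 < a j)
    (c : Fin (N + 1) → ℕ) :
    ∫⁻ x, ENNReal.ofReal (∏ j, x j ^ c j) ∂dirichletMeasure a =
      ENNReal.ofReal ((∏ j, (ascPochhammer ℝ (c j)).eval (a j)) /
        (ascPochhammer ℝ (∑ j, c j)).eval (∑ j, a j)) := by
  have hsum : 0 < ∑ j, a j := Finset.sum_pos (fun j _ => ha j) Finset.univ_nonempty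
  have hΓ : 0 < ∏ j, Real.Gamma (a j) := Finset.prod_pos fun j _ => Real.Gamma_pos_of_pos (ha j)
  have hC : 0 ≤ Real.Gamma (∑ j, a j) / ∏ j, Real.Gamma (a j) :=
    (div_pos (Real.Gamma_pos_of_pos hsum) hΓ).le
  have hprod (y : Fin N → ℝ) : ∏ j, simplexPoint y j ^ c j =
      (1 - ∑ i, y i) ^ c 0 * ∏ i, y i ^ c i.succ := Fin.prod_univ_succ _
  rw [dirichletMeasure, lintegral_map (by fun_prop) (by fun_prop),
    lintegral_withDensity_eq_lintegral_mul _ (by fun_prop) (by fun_prop)]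
  simp only [Pi.mul_apply, mul_assoc, hprod]
  rw [lintegral_const_mul' _ _ ENNReal.ofReal_ne_top,
    lintegral_dirichletWeight_mul_prod_pow (fun i => ha i.succ) (ha 0) (fun i => c i.succ) (c 0),
    ← ENNReal.ofReal_mul hC]
  congr 1
  simp only [ascPochhammer_eval_eq_Gamma_div, ha, hsum, Finset.prod_div_distrib, Nat.cast_sum,
    ← Finset.sum_add_distrib]
  rw [Fin.prod_univ_succ fun j => Real.Gamma (a j + c j), Fin.sum_univ_succ fun j => a j + c j,
    add_comm (a 0 + _), mul_comm (Real.Gamma (a 0 + _))]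
  rw [div_mul_div_comm, div_div_div_eq, mul_comm (Real.Gamma (∑ j, a j))]

end DirichletMeasure

section Sorting

/-- The coordinates of `x` in decreasing order, followed by zeros. -/
noncomputable def sortedSeq {m : ℕ} (x : Fin m → ℝ) (i : ℕ) : ℝ :=
  if h : i < m then x (Tuple.sort (fun j => -x j) ⟨i, h⟩) else 0

lemma sortedSeq_nonneg {m : ℕ} {x : Fin m → ℝ} (hx : 0 ≤ x) (i : ℕ) : 0 ≤ sortedSeq x i := by
  rw [sortedSeq]
  split_ifs
  exacts [hx _, le_rfl]

lemma antitone_sortedSeq {m : ℕ} {x : Fin m → ℝ} (hx : 0 ≤ x) : Antitone (sortedSeq x) := by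
  intro i j hij
  by_cases hj : j < m
  · rw [sortedSeq, sortedSeq, dif_pos hj, dif_pos (hij.trans_lt hj)]
    exact neg_le_neg_iff.1 (Tuple.monotone_sort (fun l => -x l)
      (show (⟨i, hij.trans_lt hj⟩ : Fin m) ≤ ⟨j, hj⟩ from hij))
  · rw [sortedSeq, dif_neg hj]
    exact sortedSeq_nonneg hx i

lemma hasSum_sortedSeq_pow {m : ℕ} (x : Fin m → ℝ) {k : ℕ} (hk : k ≠ 0) :
    HasSum (fun i => sortedSeq x i ^ k) (∑ j, x j ^ k) := by
  have hsum : ∑ i ∈ Finset.range m, sortedSeq x i ^ k = ∑ j, x j ^ k := by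
    rw [Finset.sum_range]
    refine Eq.trans ?_ (Equiv.sum_comp (Tuple.sort fun j => -x j) fun j => x j ^ k)
    simp [sortedSeq]
  rw [← hsum]
  refine hasSum_sum_of_ne_finset_zero fun i hi => ?_
  rw [sortedSeq, dif_neg (Finset.mem_range.not.1 hi), zero_pow hk]

/-- The point of `Δ` obtained by sorting the coordinates of a probability vector. -/
noncomputable def sortDesc {m : ℕ} (x : stdSimplex ℝ (Fin m)) : simplex :=
  have hsum : HasSum (sortedSeq x.1) 1 := by
    simpa only [pow_one, x.2.2] using hasSum_sortedSeq_pow x.1 one_ne_zero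
  ⟨sortedSeq x.1, antitone_sortedSeq x.2.1, sortedSeq_nonneg x.2.1, hsum.summable, hsum.tsum_eq.le⟩

lemma extPowerSum_sortDesc {m : ℕ} (x : stdSimplex ℝ (Fin m)) (k : ℕ+) :
    extPowerSum (sortDesc x) k = ∑ j, x.1 j ^ (k : ℕ) := by
  by_cases hk : k = 1
  · subst hk
    simp only [extPowerSum_one, PNat.one_coe, pow_one, x.2.2]
  · rw [extPowerSum_of_ne hk]
    exact (hasSum_sortedSeq_pow x.1 k.ne_zero).tsum_eq

lemma continuous_sortDesc {m : ℕ} : Continuous (sortDesc (m := m)) := by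
  refine isClosedEmbedding_extPowerSum.isInducing.continuous_iff.2 (continuous_pi fun k => ?_)
  simp only [Function.comp_apply, extPowerSum_sortDesc]
  exact continuous_finsetSum _ fun j _ => ((continuous_apply j).comp continuous_subtype_val).pow _

lemma specialize_sortDesc {ι : Type*} [Fintype ι] {k : ι → ℕ} {f : SymFun}
    (hf : IsAugmentedMonomial k f) {m : ℕ} (x : stdSimplex ℝ (Fin m)) :
    specialize (sortDesc x) f = augSum k x.1 := by
  rw [← eval_toPoly_eq_augSum hf, eval_toPoly]
  exact congrArg (MvPolynomial.eval · f) (funext (extPowerSum_sortDesc x))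

end Sorting

section Existence

lemma integral_prod_pow_eq_toReal {ι : Type*} [Fintype ι] {μ : Measure (ι → ℝ)}
    (hμ : ∀ᵐ x ∂μ, 0 ≤ x) (c : ι → ℕ) :
    ∫ x, ∏ j, x j ^ c j ∂μ = (∫⁻ x, ENNReal.ofReal (∏ j, x j ^ c j) ∂μ).toReal :=
  integral_eq_lintegral_of_nonneg_ae
    (hμ.mono fun _ hx => Finset.prod_nonneg fun j _ => pow_nonneg (hx j) _)
    (Measurable.aestronglyMeasurable (by fun_prop))

/-- The Dirichlet distribution as a measure on the standard simplex. -/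
noncomputable def stdSimplexDirichlet {N : ℕ} (a : Fin (N + 1) → ℝ) :
    Measure (stdSimplex ℝ (Fin (N + 1))) :=
  (dirichletMeasure a).comap Subtype.val

lemma integral_stdSimplexDirichlet {N : ℕ} (a : Fin (N + 1) → ℝ) (f : (Fin (N + 1) → ℝ) → ℝ) :
    ∫ x, f x.1 ∂stdSimplexDirichlet a = ∫ x, f x ∂dirichletMeasure a := by
  rw [stdSimplexDirichlet, integral_subtype_comap (isClosed_stdSimplex ℝ _).measurableSet,
    Measure.restrict_eq_self_of_ae_mem (ae_dirichletMeasure_mem_stdSimplex a)]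

variable {N : ℕ} {a : Fin (N + 1) → ℝ}

lemma isProbabilityMeasure_dirichletMeasure (ha : ∀ j, 0 < a j) :
    IsProbabilityMeasure (dirichletMeasure a) :=
  ⟨by simpa using lintegral_prod_pow_dirichletMeasure ha 0⟩

lemma isProbabilityMeasure_stdSimplexDirichlet (ha : ∀ j, 0 < a j) :
    IsProbabilityMeasure (stdSimplexDirichlet a) := by
  have := isProbabilityMeasure_dirichletMeasure ha
  refine ⟨?_⟩
  rw [stdSimplexDirichlet, comap_subtype_coe_apply (isClosed_stdSimplex ℝ _).measurableSet,
    Set.image_univ, Subtype.range_coe]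
  exact (mem_ae_iff_prob_eq_one (isClosed_stdSimplex ℝ _).measurableSet).1
    (ae_dirichletMeasure_mem_stdSimplex a)

lemma integral_prod_pow_stdSimplexDirichlet (ha : ∀ j, 0 < a j) (c : Fin (N + 1) → ℕ) :
    ∫ x, ∏ j, x.1 j ^ c j ∂stdSimplexDirichlet a =
      (∏ j, (ascPochhammer ℝ (c j)).eval (a j)) /
        (ascPochhammer ℝ (∑ j, c j)).eval (∑ j, a j) := by
  have hsum : 0 < ∑ j, a j := Finset.sum_pos (fun j _ => ha j) Finset.univ_nonempty
  rw [integral_stdSimplexDirichlet a fun x => ∏ j, x j ^ c j, integral_prod_pow_eq_toReal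
    ((ae_dirichletMeasure_mem_stdSimplex a).mono fun x hx => hx.1),
    lintegral_prod_pow_dirichletMeasure ha, ENNReal.toReal_ofReal]
  exact div_nonneg (Finset.prod_nonneg fun j _ => (ascPochhammer_pos _ _ (ha j)).le)
    (ascPochhammer_pos _ _ hsum).le

variable {ι : Type*} [Fintype ι]

lemma integral_prod_comp_embedding {s : ℝ} (hs : 0 < s) (k : ι → ℕ) (g : ι ↪ Fin (N + 1)) :
    ∫ x, ∏ i, x.1 (g i) ^ k i ∂stdSimplexDirichlet (fun _ : Fin (N + 1) => s) =
      (∏ i, (ascPochhammer ℝ (k i)).eval s) /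
        (ascPochhammer ℝ (∑ i, k i)).eval ((N + 1) * s) := by
  let c := Function.extend g k 0
  have c_apply (i : ι) : c (g i) = k i := g.injective.extend_apply k 0 i
  have c_eq_zero {j : Fin (N + 1)} (hj : j ∉ Set.range g) : c j = 0 :=
    Function.extend_apply' _ _ _ hj
  have hx (x : Fin (N + 1) → ℝ) : ∏ i, x (g i) ^ k i = ∏ j, x j ^ c j :=
    Fintype.prod_of_injective g g.injective _ _ (fun j hj => by rw [c_eq_zero hj, pow_zero])
      fun i => by rw [c_apply]
  have hasc : ∏ i, (ascPochhammer ℝ (k i)).eval s = ∏ j, (ascPochhammer ℝ (c j)).eval s :=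
    Fintype.prod_of_injective g g.injective _ _ (fun j hj => by simp [c_eq_zero hj])
      fun i => by rw [c_apply]
  have hsum : ∑ i, k i = ∑ j, c j :=
    Fintype.sum_of_injective g g.injective _ _ (fun _ => c_eq_zero) fun i => (c_apply i).symm
  simp only [hx, hasc, hsum, integral_prod_pow_stdSimplexDirichlet fun _ => hs]
  simp

lemma integral_augSum_stdSimplexDirichlet {s : ℝ} (hs : 0 < s) (k : ι → ℕ) :
    ∫ x, augSum k x.1 ∂stdSimplexDirichlet (fun _ : Fin (N + 1) => s) =
      (N + 1).descFactorial (Fintype.card ι) * (∏ i, (ascPochhammer ℝ (k i)).eval s) /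
        (ascPochhammer ℝ (∑ i, k i)).eval ((N + 1) * s) := by
  have := isProbabilityMeasure_stdSimplexDirichlet fun _ : Fin (N + 1) => hs
  have hcont (g : ι ↪ Fin (N + 1)) :
      Continuous fun x : stdSimplex ℝ (Fin (N + 1)) => ∏ i, x.1 (g i) ^ k i :=
    continuous_finsetProd _ fun i _ => ((continuous_apply _).comp continuous_subtype_val).pow _
  simp only [augSum]
  rw [integral_finsetSum _ fun g _ => integrable_of_continuous (hcont g)]
  simp only [integral_prod_comp_embedding hs, Finset.sum_const, Finset.card_univ,
    Fintype.card_embedding_eq, Fintype.card_fin, nsmul_eq_mul, mul_div_assoc]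

variable {t : ℝ}

lemma tendsto_descFactorial_div_pow (l : ℕ) :
    Tendsto (fun N : ℕ => ((N + 1).descFactorial l : ℝ) / (N + 1) ^ l) atTop (𝓝 1) := by
  have h := (Asymptotics.isEquivalent_iff_tendsto_one ?_).1 (isEquivalent_descFactorial l)
  · simpa [Function.comp_def] using h.comp (tendsto_add_atTop_nat 1)
  · filter_upwards [eventually_gt_atTop 0] with n hn
    positivity

lemma tendsto_mul_ascPochhammer_eval_div {k : ℕ} (hk : 0 < k) (t : ℝ) :
    Tendsto (fun N : ℕ => ((N : ℝ) + 1) * (ascPochhammer ℝ k).eval (t / (N + 1))) atTop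
      (𝓝 (t * (k - 1).factorial)) := by
  obtain ⟨k, rfl⟩ := Nat.exists_eq_add_one.2 hk
  have hN (N : ℕ) : ((N : ℝ) + 1) * (ascPochhammer ℝ (k + 1)).eval (t / (N + 1)) =
      t * (ascPochhammer ℝ k).eval (t / (N + 1) + 1) := by
    have : (N : ℝ) + 1 ≠ 0 := by positivity
    rw [ascPochhammer_succ_left, Polynomial.eval_mul, Polynomial.eval_X, Polynomial.eval_comp,
      ← mul_assoc, mul_div_cancel₀ _ this]
    simp
  have hdiv : Tendsto (fun N : ℕ => t / ((N : ℝ) + 1)) atTop (𝓝 0) := by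
    simpa [div_eq_mul_one_div t] using tendsto_one_div_add_atTop_nhds_zero_nat.const_mul t
  simp only [hN, Nat.add_sub_cancel, ← ascPochhammer_eval_one ℝ k]
  have := ((ascPochhammer ℝ k).continuous.tendsto _).comp (hdiv.add_const 1)
  simpa using this.const_mul t

lemma tendsto_integral_augSum_stdSimplexDirichlet (ht : 0 < t) {k : ι → ℕ} (hk : ∀ i, 0 < k i) :
    Tendsto (fun N => ∫ x, augSum k x.1 ∂stdSimplexDirichlet fun _ : Fin (N + 1) => t / (N + 1))
      atTop (𝓝 (augMoment t k)) := by
  have hprod := (tendsto_descFactorial_div_pow (Fintype.card ι)).mul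
    (tendsto_finsetProd Finset.univ fun i _ => tendsto_mul_ascPochhammer_eval_div (hk i) t)
  have hlim := hprod.div_const ((ascPochhammer ℝ (∑ i, k i)).eval t)
  rw [one_mul, Finset.prod_mul_distrib, Finset.prod_const, Finset.card_univ] at hlim
  refine hlim.congr fun N => ?_
  have hN : (N : ℝ) + 1 ≠ 0 := by positivity
  rw [integral_augSum_stdSimplexDirichlet (by positivity), mul_div_cancel₀ _ hN,
    Finset.prod_mul_distrib, Finset.prod_const, Finset.card_univ, ← mul_assoc,
    div_mul_cancel₀ _ (pow_ne_zero _ hN)]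

lemma exists_integral_eq_of_tendsto {E : Type*} [TopologicalSpace E] [CompactSpace E] [T2Space E]
    [MeasurableSpace E] [BorelSpace E] (Q : ℕ → ProbabilityMeasure E) :
    ∃ P : ProbabilityMeasure E, ∀ (f : C(E, ℝ)) (l : ℝ),
      Tendsto (fun N => ∫ x, f x ∂Q N) atTop (𝓝 l) → ∫ x, f x ∂P = l := by
  let U := (hyperfilter ℕ).map Q
  have hQ : Tendsto Q (hyperfilter ℕ) (𝓝 U.lim) := U.le_nhds_lim
  refine ⟨U.lim, fun f l hf => ?_⟩
  exact tendsto_nhds_unique (ProbabilityMeasure.tendsto_iff_forall_integral_tendsto.1 hQ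
    (BoundedContinuousFunction.mkOfCompact f)) (hf.mono_left Nat.hyperfilter_le_atTop)

lemma exists_isPoissonDirichlet (ht : 0 < t) : ∃ P : Measure simplex, IsPoissonDirichlet t P := by
  let D (N : ℕ) := stdSimplexDirichlet fun _ : Fin (N + 1) => t / (N + 1)
  have hD (N : ℕ) : IsProbabilityMeasure (D N) :=
    isProbabilityMeasure_stdSimplexDirichlet fun _ => by positivity
  obtain ⟨P, hP⟩ := exists_integral_eq_of_tendsto fun N =>
    ⟨(D N).map sortDesc, Measure.isProbabilityMeasure_map continuous_sortDesc.aemeasurable⟩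
  refine ⟨P, isPoissonDirichlet_of_integral_augmentedMonomial fun n k f hk hf => ?_⟩
  refine hP ⟨_, continuous_specialize f⟩ _
    ((tendsto_integral_augSum_stdSimplexDirichlet ht hk).congr fun N => ?_)
  refine Eq.symm ((integral_map continuous_sortDesc.aemeasurable
    (continuous_specialize f).aestronglyMeasurable).trans ?_)
  simp only [specialize_sortDesc hf, D]

end Existence

section ControllingMeasures

lemma lintegral_thomaMeasure (α : simplex) {f : ℝ → ENNReal} (hf : Measurable f) :
    ∫⁻ x, f x ∂thomaMeasure α =
      ∑' i, ENNReal.ofReal (α.1 i) * f (α.1 i) + ENNReal.ofReal (gam α) * f 0 := by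
  simp only [thomaMeasure, lintegral_add_measure, lintegral_sum_measure, lintegral_smul_measure,
    lintegral_dirac' _ hf, smul_eq_mul]

lemma lintegral_thomaMeasure_pow (α : simplex) (c : ℕ) :
    ∫⁻ x, ENNReal.ofReal x ^ c ∂thomaMeasure α = ENNReal.ofReal (extPowerSum α c.succPNat) := by
  have hpow (i : ℕ) : ENNReal.ofReal (α.1 i) * ENNReal.ofReal (α.1 i) ^ c =
      ENNReal.ofReal (α.1 i ^ (c + 1)) := by
    rw [← pow_succ', ENNReal.ofReal_pow (α.2.2.1 i)]
  have hnonneg (i : ℕ) : 0 ≤ α.1 i ^ (c + 1) := pow_nonneg (α.2.2.1 i) _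
  rw [lintegral_thomaMeasure α (by fun_prop), tsum_congr hpow,
    ← ENNReal.ofReal_tsum_of_nonneg hnonneg (simplex.summable_pow α c.succ_pos)]
  cases c with
  | zero =>
    rw [pow_zero, mul_one, ← ENNReal.ofReal_add (tsum_nonneg hnonneg) (gam_nonneg α)]
    simp [show Nat.succPNat 0 = 1 from rfl, extPowerSum_one, gam]
  | succ c => simp [extPowerSum_add_two]

lemma isProbabilityMeasure_thomaMeasure (α : simplex) : IsProbabilityMeasure (thomaMeasure α) := by
  have hmoment := lintegral_thomaMeasure_pow α 0
  rw [show Nat.succPNat 0 = 1 from rfl, extPowerSum_one] at hmoment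
  exact ⟨by simpa using hmoment⟩

lemma ae_thomaMeasure_mem_Icc (α : simplex) : ∀ᵐ x ∂thomaMeasure α, x ∈ Set.Icc (0 : ℝ) 1 := by
  have hs : MeasurableSet (Set.Icc (0 : ℝ) 1)ᶜ := measurableSet_Icc.compl
  rw [ae_iff]
  change thomaMeasure α (Set.Icc 0 1)ᶜ = 0
  rw [← lintegral_indicator_one hs, lintegral_thomaMeasure α (measurable_one.indicator hs)]
  simp [α.2.2.1, simplex.apply_le_one α]

lemma measurable_coord (i : ℕ) : Measurable fun α : simplex => α.1 i :=
  (measurable_pi_apply i).comp measurable_subtype_coe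

lemma measurable_gam : Measurable gam := by
  have h (α : simplex) : gam α = 1 - (∑' i, ENNReal.ofReal (α.1 i)).toReal := by
    rw [← ENNReal.ofReal_tsum_of_nonneg α.2.2.1 α.2.2.2.1,
      ENNReal.toReal_ofReal (tsum_nonneg α.2.2.1), gam]
  rw [funext h]
  exact (Measurable.tsum fun i => (measurable_coord i).ennreal_ofReal).ennreal_toReal.const_sub 1

lemma measurable_thomaMeasure : Measurable thomaMeasure := by
  refine Measure.measurable_of_measurable_coe _ fun s hs => ?_
  have hind : Measurable (s.indicator (1 : ℝ → ENNReal)) := measurable_one.indicator hs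
  simp only [← lintegral_indicator_one hs, lintegral_thomaMeasure _ hind]
  exact (Measurable.tsum fun i => (measurable_coord i).ennreal_ofReal.mul
    (hind.comp (measurable_coord i))).add (measurable_gam.ennreal_ofReal.mul_const _)

variable {n : ℕ}

lemma measurable_pi_thomaMeasure :
    Measurable fun α => Measure.pi fun _ : Fin n => thomaMeasure α := by
  have := isProbabilityMeasure_thomaMeasure
  refine Measurable.measure_of_isPiSystem_of_isProbabilityMeasure generateFrom_pi.symm
    isPiSystem_pi ?_
  rintro _ ⟨s, hs, rfl⟩
  simp only [Measure.pi_pi]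
  exact Finset.measurable_prod _ fun j _ =>
    have hsj : MeasurableSet (s j) := hs j trivial
    (Measure.measurable_coe hsj).comp measurable_thomaMeasure

lemma ae_controllingMeasure_mem_Icc (P : Measure simplex) :
    ∀ᵐ x ∂controllingMeasure P n, x ∈ Set.Icc 0 1 := by
  have := isProbabilityMeasure_thomaMeasure
  have ae_pi (α : simplex) :
      ∀ᵐ x ∂(Measure.pi fun _ : Fin n => thomaMeasure α), x ∈ Set.Icc 0 1 := by
    have ae_apply (j : Fin n) :
        ∀ᵐ x ∂(Measure.pi fun _ : Fin n => thomaMeasure α), x j ∈ Set.Icc (0 : ℝ) 1 :=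
      Measure.tendsto_eval_ae_ae.eventually (ae_thomaMeasure_mem_Icc α)
    exact (ae_all_iff.2 ae_apply).mono fun x hx => ⟨fun j => (hx j).1, fun j => (hx j).2⟩
  rw [ae_iff]
  change controllingMeasure P n (Set.Icc 0 1)ᶜ = 0
  rw [controllingMeasure, Measure.bind_apply measurableSet_Icc.compl
    measurable_pi_thomaMeasure.aemeasurable]
  exact lintegral_eq_zero_of_ae_eq_zero (ae_of_all _ ae_pi)

lemma lintegral_pi_thomaMeasure (α : simplex) (c : Fin n → ℕ) :
    ∫⁻ x, ∏ j, ENNReal.ofReal (x j) ^ c j ∂(Measure.pi fun _ => thomaMeasure α) =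
      ENNReal.ofReal (∏ j, extPowerSum α (c j).succPNat) := by
  have := isProbabilityMeasure_thomaMeasure
  have hpow (j : Fin n) : Measurable fun x : ℝ => ENNReal.ofReal x ^ c j := by fun_prop
  rw [ProbabilityTheory.lintegral_prod_eq_prod_lintegral_of_indepFun Finset.univ
    (fun j (x : Fin n → ℝ) => ENNReal.ofReal (x j) ^ c j)
    (ProbabilityTheory.iIndepFun_pi fun j => (hpow j).aemeasurable)
    fun j => (hpow j).comp (measurable_pi_apply j),
    ENNReal.ofReal_prod_of_nonneg fun j _ => extPowerSum_nonneg α _]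
  refine Finset.prod_congr rfl fun j _ => ?_
  rw [← lintegral_thomaMeasure_pow]
  exact (measurePreserving_eval (fun _ => thomaMeasure α) j).lintegral_comp (hpow j)

lemma lintegral_controllingMeasure {t : ℝ} {P : Measure simplex} (hP : IsPoissonDirichlet t P)
    (c : Fin n → ℕ) :
    ∫⁻ x, ∏ j, ENNReal.ofReal (x j) ^ c j ∂controllingMeasure P n =
      ENNReal.ofReal (∑ π : Finpartition (Finset.univ : Finset (Fin n)),
        augMoment t (blockSum π fun j => c j + 1)) := by
  have := hP.isProbabilityMeasure
  have hcont : Continuous fun α => ∏ j, extPowerSum α (c j).succPNat :=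
    continuous_finsetProd _ fun j _ => continuous_extPowerSum _
  rw [controllingMeasure, Measure.lintegral_bind measurable_pi_thomaMeasure.aemeasurable
    (Measurable.aemeasurable (by fun_prop)),
    ← hP.integral_prod_extPowerSum fun j => (c j).succ_pos]
  simp only [lintegral_pi_thomaMeasure]
  exact (ofReal_integral_eq_lintegral_ofReal (integrable_of_continuous hcont)
    (ae_of_all _ fun α => Finset.prod_nonneg fun j _ => extPowerSum_nonneg α _)).symm

lemma isProbabilityMeasure_controllingMeasure (P : Measure simplex) [IsProbabilityMeasure P] :
    IsProbabilityMeasure (controllingMeasure P n) := by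
  have := isProbabilityMeasure_thomaMeasure
  refine ⟨?_⟩
  rw [controllingMeasure, Measure.bind_apply .univ measurable_pi_thomaMeasure.aemeasurable]
  simp

end ControllingMeasures

section SectionMeasures

variable {n r : ℕ} {π : SetPartition n r} {t : ℝ}

lemma measurable_comp_blockIndex (e : π.Enumeration) :
    Measurable fun (y : Fin r → ℝ) j => y (SetPartition.blockIndex e j) :=
  measurable_pi_lambda _ fun _ => measurable_pi_apply _

lemma dirichletTypeMeasure_eq (ht : 0 ≤ t) (e : π.Enumeration) :
    dirichletTypeMeasure t e = ENNReal.ofReal (t ^ r) •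
      (volume.restrict (Set.Icc 0 1)).withDensity fun y =>
        ENNReal.ofReal (dirichletWeight (fun i => ((e i).1.card : ℝ)) t y) := by
  rw [← withDensity_smul _ (by fun_prop), dirichletTypeMeasure]
  congr 1 with y
  have hpow (i : Fin r) : y i ^ ((e i).1.card - 1) = y i ^ (((e i).1.card : ℝ) - 1) := by
    rw [← Real.rpow_natCast, Nat.cast_pred (π.1.nonempty_of_mem_parts (e i).2).card_pos]
  simp only [hpow, mul_assoc, Pi.smul_apply, smul_eq_mul, dirichletWeight,
    ENNReal.ofReal_mul (pow_nonneg ht r)]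

lemma ae_sectionMeasure_mem_Icc (t : ℝ) (e : π.Enumeration) :
    ∀ᵐ x ∂sectionMeasure t e, x ∈ Set.Icc 0 1 := by
  refine (ae_map_iff (measurable_comp_blockIndex e).aemeasurable measurableSet_Icc).2
    ((withDensity_absolutelyContinuous _ _).ae_le ?_)
  filter_upwards [ae_restrict_mem measurableSet_Icc] with y hy
  exact ⟨fun j => hy.1 _, fun j => hy.2 _⟩

lemma prod_blockIndex_pow (e : π.Enumeration) (y : Fin r → ℝ) (c : Fin n → ℕ) :
    ∏ j, y (SetPartition.blockIndex e j) ^ c j = ∏ i, y i ^ blockSum π.1 c (e i) := by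
  rw [← e.symm.prod_comp]
  simp only [Equiv.apply_symm_apply]
  exact prod_block_pow π.1 (fun B => y (e.symm B)) c

lemma augMoment_comp_equiv {ι κ : Type*} [Fintype ι] [Fintype κ] (e : ι ≃ κ) (k : κ → ℕ) :
    augMoment t (k ∘ e) = augMoment t k := by
  simp only [augMoment, Function.comp_apply, Fintype.card_congr e,
    e.sum_comp k, e.prod_comp fun B => ((k B - 1).factorial : ℝ)]

lemma augMoment_eq_Gamma {ι : Type*} [Fintype ι] (ht : 0 < t) {k : ι → ℕ} (hk : ∀ i, 0 < k i) :
    augMoment t k = t ^ Fintype.card ι *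
      ((∏ i, Real.Gamma (k i)) * Real.Gamma t / Real.Gamma (∑ i, (k i : ℝ) + t)) := by
  have hfac (i : ι) : ((k i - 1).factorial : ℝ) = Real.Gamma (k i) := by
    rw [← Real.Gamma_nat_eq_factorial, Nat.cast_pred (hk i), sub_add_cancel]
  rw [augMoment, ascPochhammer_eval_eq_Gamma_div ht, Nat.cast_sum, add_comm t, div_div_eq_mul_div,
    mul_assoc, mul_div_assoc, Finset.prod_congr rfl fun i _ => hfac i]

lemma lintegral_sectionMeasure_eq_lintegral_dirichletWeight (ht : 0 ≤ t) (e : π.Enumeration)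
    (c : Fin n → ℕ) :
    ∫⁻ x, ∏ j, ENNReal.ofReal (x j) ^ c j ∂sectionMeasure t e =
      ENNReal.ofReal (t ^ r) * ∫⁻ y in Set.Icc 0 1,
        ENNReal.ofReal (dirichletWeight (fun i => ((e i).1.card : ℝ)) t y) *
          ENNReal.ofReal (∏ i, y i ^ blockSum π.1 c (e i)) := by
  rw [sectionMeasure, lintegral_map (by fun_prop) (measurable_comp_blockIndex e),
    dirichletTypeMeasure_eq ht, lintegral_smul_measure, smul_eq_mul,
    lintegral_withDensity_eq_lintegral_mul _ (by fun_prop) (by fun_prop)]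
  congr 1
  refine setLIntegral_congr_fun measurableSet_Icc fun y hy => ?_
  rw [Pi.mul_apply, ← prod_blockIndex_pow,
    ENNReal.ofReal_prod_of_nonneg fun j _ => pow_nonneg (hy.1 _) _]
  simp only [ENNReal.ofReal_pow (hy.1 _)]

lemma lintegral_sectionMeasure (ht : 0 < t) (e : π.Enumeration) (c : Fin n → ℕ) :
    ∫⁻ x, ∏ j, ENNReal.ofReal (x j) ^ c j ∂sectionMeasure t e =
      ENNReal.ofReal (augMoment t (blockSum π.1 fun j => c j + 1)) := by
  have hcard (i : Fin r) : (0 : ℝ) < (e i).1.card :=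
    Nat.cast_pos.2 (π.1.nonempty_of_mem_parts (e i).2).card_pos
  have hblock (i : Fin r) : (blockSum π.1 (fun j => c j + 1) (e i) : ℝ) =
      (e i).1.card + blockSum π.1 c (e i) := by
    simp [blockSum, Finset.sum_add_distrib, add_comm]
  have hpos (i : Fin r) : 0 < ((blockSum π.1 fun j => c j + 1) ∘ e) i :=
    blockSum_pos _ (fun j => (c j).succ_pos) _
  have hdirichlet := lintegral_dirichletWeight_mul_prod_pow hcard ht
    (fun i => blockSum π.1 c (e i)) 0
  simp only [pow_zero, one_mul, Nat.cast_zero, add_zero] at hdirichlet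
  rw [lintegral_sectionMeasure_eq_lintegral_dirichletWeight ht.le, hdirichlet,
    ← ENNReal.ofReal_mul (by positivity), ← augMoment_comp_equiv e,
    augMoment_eq_Gamma ht hpos]
  simp only [Function.comp_apply, hblock, Fintype.card_fin]

end SectionMeasures

section MomentComparison

variable {n : ℕ} {t : ℝ}

lemma ext_of_lintegral_prod_pow_eq {ι : Type*} [Fintype ι] {μ ν : Measure (ι → ℝ)}
    [IsFiniteMeasure μ] (hμ : ∀ᵐ x ∂μ, x ∈ Set.Icc 0 1) (hν : ∀ᵐ x ∂ν, x ∈ Set.Icc 0 1)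
    (h : ∀ c : ι → ℕ, ∫⁻ x, ∏ i, ENNReal.ofReal (x i) ^ c i ∂μ =
      ∫⁻ x, ∏ i, ENNReal.ofReal (x i) ^ c i ∂ν) : μ = ν := by
  have huniv : μ Set.univ = ν Set.univ := by simpa using h 0
  have : IsFiniteMeasure ν := ⟨huniv ▸ measure_lt_top μ _⟩
  have ofReal_prod {x : ι → ℝ} (hx : x ∈ Set.Icc 0 1) (c : ι → ℕ) :
      ENNReal.ofReal (∏ i, x i ^ c i) = ∏ i, ENNReal.ofReal (x i) ^ c i := by
    rw [ENNReal.ofReal_prod_of_nonneg fun i _ => pow_nonneg (hx.1 i) _]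
    exact Finset.prod_congr rfl fun i _ => ENNReal.ofReal_pow (hx.1 i) _
  refine ext_of_integral_prod_pow_eq isCompact_Icc hμ hν fun c => ?_
  rw [integral_prod_pow_eq_toReal (hμ.mono fun _ hx => hx.1),
    integral_prod_pow_eq_toReal (hν.mono fun _ hx => hx.1),
    lintegral_congr_ae (hμ.mono fun _ hx => ofReal_prod hx c),
    lintegral_congr_ae (hν.mono fun _ hx => ofReal_prod hx c), h]

lemma augMoment_nonneg {ι : Type*} [Fintype ι] (ht : 0 < t) (k : ι → ℕ) : 0 ≤ augMoment t k := by
  have := ascPochhammer_pos (∑ i, k i) t ht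
  unfold augMoment
  positivity

lemma sum_finpartition_eq_sum_setPartition {M : Type*} [AddCommMonoid M] (hn : 1 ≤ n)
    (F : Finpartition (Finset.univ : Finset (Fin n)) → M) :
    ∑ π, F π = ∑ r ∈ Finset.Icc 1 n, ∑ π : SetPartition n r, F π.1 := by
  have card_mem (π : Finpartition (Finset.univ : Finset (Fin n))) :
      π.parts.card ∈ Finset.Icc 1 n := by
    have : Nonempty (Fin n) := ⟨⟨0, hn⟩⟩
    exact Finset.mem_Icc.2 ⟨(π.parts_nonempty Finset.univ_nonempty.ne_empty).card_pos,
      π.card_parts_le_card.trans_eq (Finset.card_fin n)⟩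
  rw [← Finset.sum_fiberwise_of_maps_to fun π _ => card_mem π]
  exact Finset.sum_congr rfl fun r _ => Finset.sum_subtype _ (by simp) F

lemma controllingMeasure_eq (ht : 0 < t) {P : Measure simplex} (hP : IsPoissonDirichlet t P)
    (hn : 1 ≤ n) (e : ∀ (r : ℕ) (π : SetPartition n r), π.Enumeration) :
    controllingMeasure P n =
      ∑ r ∈ Finset.Icc 1 n, ∑ π : SetPartition n r, sectionMeasure t (e r π) := by
  have := hP.isProbabilityMeasure
  have := isProbabilityMeasure_controllingMeasure (n := n) P
  refine ext_of_lintegral_prod_pow_eq (ae_controllingMeasure_mem_Icc P) ?_ fun c => ?_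
  · simp only [ae_iff, Measure.coe_finsetSum, Finset.sum_apply]
    exact Finset.sum_eq_zero fun r _ => Finset.sum_eq_zero fun π _ =>
      ae_iff.1 (ae_sectionMeasure_mem_Icc t (e r π))
  · rw [lintegral_controllingMeasure hP,
      ENNReal.ofReal_sum_of_nonneg fun π _ => augMoment_nonneg ht _,
      sum_finpartition_eq_sum_setPartition hn]
    simp only [lintegral_finsetSum_measure, lintegral_sectionMeasure ht]

end MomentComparison

end PoissonDirichlet

theorem theorem7p1 (t : ℝ) (ht : 0 < t) :
    (∃! P : MeasureTheory.Measure PoissonDirichlet.simplex,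
      PoissonDirichlet.IsPoissonDirichlet t P) ∧
    ∀ P : MeasureTheory.Measure PoissonDirichlet.simplex,
      PoissonDirichlet.IsPoissonDirichlet t P →
      ∀ n : ℕ, 1 ≤ n →
      ∀ e : (∀ (r : ℕ) (π : PoissonDirichlet.SetPartition n r), π.Enumeration),
        PoissonDirichlet.controllingMeasure P n =
          ∑ r ∈ Finset.Icc 1 n, ∑ π : PoissonDirichlet.SetPartition n r,
            PoissonDirichlet.sectionMeasure t (e r π) := by
  refine ⟨?_, fun P hP n hn e => PoissonDirichlet.controllingMeasure_eq ht hP hn e⟩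
  obtain ⟨P, hP⟩ := PoissonDirichlet.exists_isPoissonDirichlet ht
  exact ⟨P, hP, fun Q hQ => hQ.unique hP⟩
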